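/- Let $$\varphi(q)=\frac{-2q\log q-(1-2q)\log(1-2q)}{-q\log q-(1-q)\log(1-q)}-1,\qquad q\in(0,1/2).$$ Then $\varphi$ is continuous and strictly decreasing on $(0,1/2)$ and maps $(0,1/2)$ bijectively onto $(0,1)$; let $\varphi^{-1}$ be its inverse, extended by $\varphi^{-1}(0)=1/2$ and $\varphi^{-1}(1)=0$. Let $G$ be a connected $d$-regular graph ($1\le d<\infty$) with vertex set $V$ and automorphism group $\mathrm{Aut}(G)$. Assume that $\mathrm{Aut}(G)$ acts transitively on $V$ and that $G$ is unimodular, i.e. the Mass-Transport Principle holds: $\sum_{v\in V}h(o,v)=\sum_{v\in V}h(v,o)$ for every $o\in V$ and every $h\colon V\times V\to[0,\infty)$ with $h(\gamma u,\gamma v)=h(u,v)$ for all $\gamma\in\mathrm{Aut}(G)$, $u,v\in V$. Let $$\tau=\inf_{W}\frac{|\partial W|}{d|W|}$$ be the normalized edge Cheeger constant, where $W$ runs over the non-empty finite subsets of $V$ and $\partial W$ is the set of edges with exactly one endpoint in $W$. A $\Gamma$-factor-of-IID independent set of $G$, for a group $\Gamma$ acting on $V$, is a random set $I=\{v: X_v=1\}$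 that is almost surely independent in $G$ and for which the $\{0,1\}$-valued process $(X_v)_{v\in V}$ is almost surely equal to $F((Z_v)_{v\in V})$, where the $Z_v$ are independent and uniform on $[0,1]$ and $F\colon[0,1]^V\to\{0,1\}^V$ is measurable and $\Gamma$-equivariant. Then for every $\mathrm{Aut}(G)$-factor-of-IID independent set $I$ of $G$, the density satisfies $$\mathbb P(o\in I)\le\varphi^{-1}(\tau)\quad\text{for every } o\in V.$$ The same bound holds if $G$ is the Cayley graph of a group $\Gamma$ with respect to a non-empty finite symmetric generating set $S\not\ni 1$ (vertices $\Gamma$, edges $\{g,gs\}$ with $g\in\Gamma$, $s\in S$, degree $d=|S|$), even if $F$ is only assumed to be equivariant under the left translations by $\Gamma$. -/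

import Mathlib

open MeasureTheory ProbabilityTheory Set
open scoped ENNReal NNReal

noncomputable section

namespace IndSetBound

/-- The action of `Γ` on `V` satisfies the Mass-Transport Principle: for every diagonally
`Γ`-invariant `h : V × V → [0, ∞)`, the total mass sent from a vertex `o` equals the total mass
received by `o`. The (possibly infinite) sums are taken in `[0, ∞]`. -/
def MassTransportPrinciple (Γ V : Type*) [Group Γ] [MulAction Γ V] : Prop :=
  ∀ h : V → V → ℝ≥0, (∀ (γ : Γ) (u v : V), h (γ • u) (γ • v) = h u v) →
    ∀ o : V, ∑' v, (h o v : ℝ≥0∞) = ∑' v, (h v o : ℝ≥0∞)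

/-- `G` is vertex-transitive: its automorphism group acts transitively on the vertices. -/
def IsTransitive {V : Type*} (G : SimpleGraph V) : Prop :=
  MulAction.IsPretransitive (G ≃g G) V

/-- A (transitive) graph is unimodular if the action of its automorphism group satisfies the
Mass-Transport Principle. -/
def IsUnimodular {V : Type*} (G : SimpleGraph V) : Prop :=
  MassTransportPrinciple (G ≃g G) V

/-- A map `A^V → B^V` is `Γ`-equivariant with respect to the action of `Γ` on
configurations given by `(γ · ω) v = ω (γ⁻¹ · v)`. -/
def IsEquivariant (Γ : Type*) {V A B : Type*} [Group Γ] [MulAction Γ V]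
    (F : (V → A) → (V → B)) : Prop :=
  ∀ (γ : Γ) (ω : V → A) (v : V), F (fun u => ω (γ⁻¹ • u)) v = F ω (γ⁻¹ • v)

/-- `Z v`, `v ∈ V`, is an IID process: independent random variables, each uniformly distributed
on `[0, 1]`. -/
structure IsUniformIID {V Ω : Type*} [MeasurableSpace Ω] (P : Measure Ω)
    (Z : V → Ω → unitInterval) : Prop where
  measurable : ∀ v, Measurable (Z v)
  indep : iIndepFun Z P
  uniform : ∀ v, P.map (Z v) = volume

/-- `X v`, `v ∈ V`, is a `Γ`-factor-of-IID process with values in `M`: it is (almost surely) the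
image of an IID process under a measurable `Γ`-equivariant map `[0, 1]^V → M^V`. -/
def IsFactorOfIID (Γ : Type*) {V Ω M : Type*} [Group Γ] [MulAction Γ V] [MeasurableSpace Ω]
    [MeasurableSpace M] (P : Measure Ω) (X : V → Ω → M) : Prop :=
  ∃ (Z : V → Ω → unitInterval) (F : (V → unitInterval) → (V → M)),
    IsUniformIID P Z ∧ Measurable F ∧ IsEquivariant Γ F ∧
      ∀ v, ∀ᵐ ω ∂P, X v ω = F (fun u => Z u ω) v

/-- `X` is (the indicator process of) a `Γ`-factor-of-IID independent set of `G`: a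
factor-of-IID process with two states such that almost surely the vertices of state `true` form
an independent set. -/
def IsFactorOfIIDIndepSet (Γ : Type*) {V Ω : Type*} [Group Γ] [MulAction Γ V]
    [MeasurableSpace Ω] (G : SimpleGraph V) (P : Measure Ω) (X : V → Ω → Bool) : Prop :=
  IsFactorOfIID Γ P X ∧ ∀ᵐ ω ∂P, G.IsIndepSet {v | X v ω = true}

/-- The edge boundary `∂W`: the set of edges with one endpoint in `W` and one outside `W`. -/
def edgeBoundary {V : Type*} (G : SimpleGraph V) (W : Set V) : Set (Sym2 V) :=
  {e | e ∈ G.edgeSet ∧ ∃ u ∈ W, ∃ v ∉ W, e = s(u, v)}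

/-- The normalized edge Cheeger constant `τ = inf |∂W| / (d |W|)` of a `d`-regular graph, the
infimum being over all non-empty finite sets `W` of vertices. -/
def cheeger {V : Type*} (G : SimpleGraph V) (d : ℕ) : ℝ :=
  ⨅ W : {W : Finset V // W.Nonempty},
    ((edgeBoundary G (W.1 : Set V)).ncard : ℝ) / ((d : ℝ) * (W.1.card : ℝ))

/-- The function `φ`; only its values on `(0, 1/2)` are used. -/
def phi (q : ℝ) : ℝ :=
  (-2 * q * Real.log q - (1 - 2 * q) * Real.log (1 - 2 * q)) /
    (-q * Real.log q - (1 - q) * Real.log (1 - q)) - 1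

/-- The inverse `φ⁻¹ : [0, 1] → [0, 1/2]` of `φ : (0, 1/2) → (0, 1)`, extended to the endpoints by
the limits `φ⁻¹(0) = 1/2` and `φ⁻¹(1) = 0`. -/
def phiInv (x : ℝ) : ℝ :=
  if x ≤ 0 then 1 / 2 else if 1 ≤ x then 0 else Function.invFunOn phi (Ioo 0 (1 / 2)) x

end IndSetBound

end

/-! The core is an edge-vertex entropy inequality: for a factor of IID `X` with two states, `d (1 +
τ) H(X_o)` is at most the sum of `H(X_o, X_v)` over the neighbours `v` of `o`. For an independent
set of density `p` the two kinds of entropy are `vertexEnt p` and `edgeEnt p`, so the inequality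
says `τ ≤ φ(p)` for `0 < p`, and monotonicity of `φ` bounds `p` (`le_phiInv`).

To prove the inequality when `X_v` depends on finitely many seeds, reveal the seeds in a uniformly
random order. Let `gain w X_v` be the expected information on `X_v` contributed by the seed of `w`.
The chain rule (`sum_gain`) says that the gains of `X_v` over all `w` add up to `H(X_v)`. The gains
are diagonally invariant (`gain_shift`), so by mass transport a single seed contributes total
information `H(X_o)` to all the variables. The function `f(v) = gain o X_v` has finite support, and
edge expansion in layer-cake form (`edgeMaxSum_ge`) bounds the sum of `max (f u) (f v)` over
oriented edges below by `d (1 + τ) ∑ f`. The gain of a pair dominates the gain of either coordinate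
(`gain_comp_le`), so transporting mass back bounds that sum above by the pair entropies.

A general factor is approximated by equivariant factors of finite range, namely the majority value
given the seeds in a ball (`edge_vertex`); entropies of finite-valued variables pass to the limit.
-/

namespace IndSetBound

/-! ### Monotonicity and range of `φ` -/

open Real Filter Topology

/-- The entropy of the pair of states at the ends of an edge, as a function of the density. -/
noncomputable def edgeEnt (q : ℝ) : ℝ := 2 * negMulLog q + negMulLog (1 - 2 * q)

/-- The entropy of the state of a vertex, as a function of the density. -/
noncomputable def vertexEnt (q : ℝ) : ℝ := negMulLog q + negMulLog (1 - q)

lemma phi_eq (q : ℝ) : phi q = edgeEnt q / vertexEnt q - 1 := by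
  unfold phi edgeEnt vertexEnt negMulLog
  congr 2 <;> ring

lemma continuous_edgeEnt : Continuous edgeEnt := by unfold edgeEnt; fun_prop

lemma continuous_vertexEnt : Continuous vertexEnt := by unfold vertexEnt; fun_prop

lemma hasDerivAt_edgeEnt {q : ℝ} (h0 : 0 < q) (h1 : q < 1 / 2) :
    HasDerivAt edgeEnt (2 * (log (1 - 2 * q) - log q)) q := by
  have h2 : HasDerivAt (fun q : ℝ => 1 - 2 * q) (-2) q := by
    simpa using ((hasDerivAt_id q).const_mul 2).const_sub 1
  have h3 := ((hasDerivAt_negMulLog h0.ne').const_mul 2).add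
    ((hasDerivAt_negMulLog (x := 1 - 2 * q) (by linarith)).comp q h2)
  exact h3.congr_deriv (by ring)

lemma hasDerivAt_vertexEnt {q : ℝ} (h0 : 0 < q) (h1 : q < 1) :
    HasDerivAt vertexEnt (log (1 - q) - log q) q := by
  have h2 : HasDerivAt (fun q : ℝ => 1 - q) (-1) q := by
    simpa using (hasDerivAt_id q).const_sub 1
  have h3 := (hasDerivAt_negMulLog h0.ne').add
    ((hasDerivAt_negMulLog (x := 1 - q) (by linarith)).comp q h2)
  exact h3.congr_deriv (by ring)

lemma vertexEnt_pos {q : ℝ} (h0 : 0 < q) (h1 : q < 1) : 0 < vertexEnt q := by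
  have h2 : 0 < negMulLog q := by
    rw [negMulLog]; nlinarith [mul_pos h0 (neg_pos.2 (log_neg h0 h1))]
  have h3 : 0 ≤ negMulLog (1 - q) := negMulLog_nonneg (by linarith) (by linarith)
  unfold vertexEnt; linarith

/-- The quotient of the derivatives of `edgeEnt` and `vertexEnt`. -/
noncomputable def derivRatio (q : ℝ) : ℝ := 2 * (log (1 - 2 * q) - log q) / (log (1 - q) - log q)

lemma log_sub_log_pos {q : ℝ} (h0 : 0 < q) (h1 : q < 1 / 2) : 0 < log (1 - q) - log q :=
  sub_pos.2 (log_lt_log h0 (by linarith))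

/-- In this form the numerator increases from its limit 0 while the denominator decreases from
infinity, which gives the monotonicity, the bound 2 and the limit 2 at 0. -/
lemma derivRatio_eq {q : ℝ} (h0 : 0 < q) (h1 : q < 1 / 2) :
    derivRatio q = 2 - 2 * ((log (1 - q) - log (1 - 2 * q)) / (log (1 - q) - log q)) := by
  have := (log_sub_log_pos h0 h1).ne'
  unfold derivRatio; field_simp; ring

lemma derivRatio_strictAntiOn : StrictAntiOn derivRatio (Ioo 0 (1 / 2)) := by
  intro a ha b hb hab
  rw [derivRatio_eq ha.1 ha.2, derivRatio_eq hb.1 hb.2]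
  obtain ⟨ha0, ha1⟩ := ha
  obtain ⟨hb0, hb1⟩ := hb
  have key : (log (1 - a) - log (1 - 2 * a)) / (log (1 - a) - log a) <
      (log (1 - b) - log (1 - 2 * b)) / (log (1 - b) - log b) := by
    apply div_lt_div₀
    · rw [← log_div (by linarith) (by linarith), ← log_div (by linarith) (by linarith)]
      apply log_lt_log (div_pos (by linarith) (by linarith))
      rw [div_lt_div_iff₀ (by linarith) (by linarith)]
      nlinarith
    · have := log_lt_log ha0 hab
      have := log_lt_log (x := 1 - b) (y := 1 - a) (by linarith) (by linarith)
      linarith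
    · exact (sub_nonneg.2 (log_le_log (by linarith) (by linarith)))
    · exact log_sub_log_pos hb0 hb1
  linarith

lemma derivRatio_lt_two {q : ℝ} (h0 : 0 < q) (h1 : q < 1 / 2) : derivRatio q < 2 := by
  rw [derivRatio_eq h0 h1]
  have : 0 < (log (1 - q) - log (1 - 2 * q)) / (log (1 - q) - log q) :=
    div_pos (sub_pos.2 (log_lt_log (by linarith) (by linarith))) (log_sub_log_pos h0 h1)
  linarith

/-- Cauchy's mean value theorem on `[0, q]`, both entropies vanishing at 0. -/
lemma exists_derivRatio_eq {q : ℝ} (h0 : 0 < q) (h1 : q < 1 / 2) :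
    ∃ c ∈ Ioo 0 q, edgeEnt q / vertexEnt q = derivRatio c := by
  obtain ⟨c, hc, h⟩ := exists_ratio_hasDerivAt_eq_ratio_slope edgeEnt
    (fun q => 2 * (log (1 - 2 * q) - log q)) h0 continuous_edgeEnt.continuousOn
    (fun x hx => hasDerivAt_edgeEnt hx.1 (hx.2.trans h1)) vertexEnt
    (fun q => log (1 - q) - log q) continuous_vertexEnt.continuousOn
    (fun x hx => hasDerivAt_vertexEnt hx.1 (by linarith [hx.2]))
  refine ⟨c, hc, ?_⟩
  have hc' := log_sub_log_pos hc.1 (hc.2.trans h1)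
  have hq := vertexEnt_pos h0 (by linarith)
  have e0 : edgeEnt 0 = 0 := by simp [edgeEnt]
  have v0 : vertexEnt 0 = 0 := by simp [vertexEnt]
  rw [e0, v0] at h
  unfold derivRatio
  rw [div_eq_div_iff hq.ne' hc'.ne']
  linarith

lemma continuousOn_phi_Ioc : ContinuousOn phi (Ioc 0 (1 / 2)) := by
  have : phi = fun q => edgeEnt q / vertexEnt q - 1 := funext phi_eq
  rw [this]
  exact (continuous_edgeEnt.continuousOn.div continuous_vertexEnt.continuousOn
    fun x hx => (vertexEnt_pos hx.1 (by linarith [hx.2])).ne').sub continuousOn_const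

/-- Monotone form of l'Hôpital's rule: the quotient is a value of the decreasing `derivRatio` at an
earlier point, hence exceeds `derivRatio q`, which makes its derivative negative. Including the
endpoint `1/2` yields positivity of `φ` from `phi_half`. -/
lemma strictAntiOn_phi_Ioc : StrictAntiOn phi (Ioc 0 (1 / 2)) := by
  apply strictAntiOn_of_deriv_neg (convex_Ioc _ _) continuousOn_phi_Ioc
  intro q hq
  rw [interior_Ioc] at hq
  obtain ⟨h0, h1⟩ := hq
  have hv := vertexEnt_pos h0 (by linarith)
  have hd := ((hasDerivAt_edgeEnt h0 h1).div
    (hasDerivAt_vertexEnt h0 (by linarith)) hv.ne').sub_const 1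
  have hphi : phi = fun q => (edgeEnt / vertexEnt) q - 1 := funext phi_eq
  rw [← hphi] at hd
  rw [hd.deriv]
  apply div_neg_of_neg_of_pos _ (by positivity)
  obtain ⟨c, hc, h⟩ := exists_derivRatio_eq h0 h1
  have hlt := derivRatio_strictAntiOn ⟨hc.1, hc.2.trans h1⟩ ⟨h0, h1⟩ hc.2
  rw [← h, derivRatio, div_lt_div_iff₀ (log_sub_log_pos h0 h1) hv] at hlt
  linarith

lemma phi_half : phi (1 / 2) = 0 := by
  rw [phi_eq]
  have h : vertexEnt (1 / 2) = edgeEnt (1 / 2) := by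
    unfold vertexEnt edgeEnt; norm_num; ring
  rw [← h, div_self (vertexEnt_pos (by norm_num) (by norm_num)).ne', sub_self]

lemma phi_pos {q : ℝ} (h0 : 0 < q) (h1 : q < 1 / 2) : 0 < phi q := by
  rw [← phi_half]
  exact strictAntiOn_phi_Ioc ⟨h0, h1.le⟩ ⟨by norm_num, le_rfl⟩ h1

lemma phi_lt_one {q : ℝ} (h0 : 0 < q) (h1 : q < 1 / 2) : phi q < 1 := by
  obtain ⟨c, hc, h⟩ := exists_derivRatio_eq h0 h1
  rw [phi_eq, h]
  linarith [derivRatio_lt_two hc.1 (hc.2.trans h1)]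

lemma derivRatio_sub_one_lt_phi {q : ℝ} (h0 : 0 < q) (h1 : q < 1 / 2) :
    derivRatio q - 1 < phi q := by
  obtain ⟨c, hc, h⟩ := exists_derivRatio_eq h0 h1
  rw [phi_eq, h]
  linarith [derivRatio_strictAntiOn ⟨hc.1, hc.2.trans h1⟩ ⟨h0, h1⟩ hc.2]

lemma tendsto_derivRatio : Tendsto derivRatio (𝓝[>] 0) (𝓝 2) := by
  have hnum : Tendsto (fun q : ℝ => log (1 - q) - log (1 - 2 * q)) (𝓝[>] 0) (𝓝 0) := by
    have : ContinuousAt (fun q : ℝ => log (1 - q) - log (1 - 2 * q)) 0 :=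
      ContinuousAt.sub (ContinuousAt.log (by fun_prop) (by norm_num))
        (ContinuousAt.log (by fun_prop) (by norm_num))
    simpa [ContinuousAt] using this.tendsto.mono_left nhdsWithin_le_nhds
  have hden : Tendsto (fun q : ℝ => log (1 - q) - log q) (𝓝[>] 0) atTop := by
    have h1 : Tendsto (fun q : ℝ => log (1 - q)) (𝓝[>] 0) (𝓝 0) := by
      have : ContinuousAt (fun q : ℝ => log (1 - q)) 0 :=
        ContinuousAt.log (by fun_prop) (by norm_num)
      simpa [ContinuousAt] using this.tendsto.mono_left nhdsWithin_le_nhds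
    have h2 : Tendsto (fun q : ℝ => - log q) (𝓝[>] 0) atTop :=
      tendsto_neg_atBot_atTop.comp tendsto_log_nhdsGT_zero
    simpa [sub_eq_add_neg] using h1.add_atTop h2
  have h := ((hnum.div_atTop hden).const_mul 2).const_sub 2
  rw [mul_zero, sub_zero] at h
  refine h.congr' ?_
  filter_upwards [Ioo_mem_nhdsGT (show (0 : ℝ) < 1 / 2 by norm_num)] with q hq
  exact (derivRatio_eq hq.1 hq.2).symm

lemma bijOn_phi : BijOn phi (Ioo 0 (1 / 2)) (Ioo 0 1) := by
  refine ⟨fun q hq => ⟨phi_pos hq.1 hq.2, phi_lt_one hq.1 hq.2⟩,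
    (strictAntiOn_phi_Ioc.mono Ioo_subset_Ioc_self).injOn, ?_⟩
  rintro y ⟨hy0, hy1⟩
  -- Since `derivRatio - 1` lies below `φ` and tends to 1 at 0, `φ` exceeds `y` at some `q`; the
  -- intermediate value theorem then applies on `[q, 1/2]`.
  obtain ⟨q, hq, hy⟩ : ∃ q ∈ Ioo (0 : ℝ) (1 / 2), y + 1 < derivRatio q :=
    (Filter.Eventually.and (Ioo_mem_nhdsGT (show (0 : ℝ) < 1 / 2 by norm_num))
      (tendsto_derivRatio.eventually_const_lt (by linarith))).exists
  have hlt := derivRatio_sub_one_lt_phi hq.1 hq.2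
  have hivt := intermediate_value_Icc' hq.2.le (continuousOn_phi_Ioc.mono
    fun x hx => ⟨hq.1.trans_le hx.1, hx.2⟩)
  obtain ⟨x, hx, rfl⟩ := hivt (show y ∈ _ from ⟨phi_half.trans_le hy0.le, by linarith⟩)
  refine ⟨x, ⟨hq.1.trans_le hx.1, lt_of_le_of_ne hx.2 ?_⟩, rfl⟩
  rintro rfl
  exact hy0.ne' phi_half

lemma phiInv_mem_Icc (t : ℝ) : phiInv t ∈ Icc (0 : ℝ) (1 / 2) := by
  unfold phiInv
  split_ifs with h0 h1
  · norm_num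
  · norm_num
  · push Not at h0 h1
    exact Ioo_subset_Icc_self (bijOn_phi.surjOn.mapsTo_invFunOn ⟨h0, h1⟩)

/-- The edge-vertex entropy inequality bounds the density. -/
lemma le_phiInv {p t : ℝ} (hp0 : 0 ≤ p) (hp1 : p ≤ 1 / 2)
    (h : (1 + t) * vertexEnt p ≤ edgeEnt p) : p ≤ phiInv t := by
  rcases hp0.eq_or_lt with rfl | hp0
  · exact (phiInv_mem_Icc t).1
  have hv := vertexEnt_pos hp0 (by linarith)
  have hphi : t ≤ phi p := by
    rw [phi_eq, le_sub_iff_add_le, le_div_iff₀ hv]; linarith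
  unfold phiInv
  split_ifs with h0 h1
  · exact hp1
  · rcases hp1.eq_or_lt with rfl | hp1
    · rw [phi_half] at hphi; linarith
    · linarith [phi_lt_one hp0 hp1]
  · push Not at h0 h1
    have hmem := bijOn_phi.surjOn.mapsTo_invFunOn (show t ∈ Ioo 0 1 from ⟨h0, h1⟩)
    have heq := bijOn_phi.surjOn.rightInvOn_invFunOn (show t ∈ Ioo 0 1 from ⟨h0, h1⟩)
    by_contra hlt
    push Not at hlt
    have := strictAntiOn_phi_Ioc (Ioo_subset_Ioc_self hmem) ⟨hp0, hp1⟩ hlt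
    rw [heq] at this
    linarith

end IndSetBound

/-! ### Edge expansion for finitely supported functions -/

namespace IndSetBound

section Expansion

variable {V : Type*} (G : SimpleGraph V)

lemma cheeger_nonneg (d : ℕ) : 0 ≤ cheeger G d :=
  Real.iInf_nonneg fun _ => by positivity

variable [G.LocallyFinite]

/-- Every boundary edge is the image of a pair (inner end, outer end). Equality holds, but only this
direction is needed to bound the outgoing pairs from below. -/
lemma ncard_edgeBoundary_le [DecidableEq V] (W : Finset V) :
    (edgeBoundary G (W : Set V)).ncard ≤ ∑ v ∈ W, (G.neighborFinset v \ W).card := by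
  have hsub : edgeBoundary G (W : Set V) ⊆
      ((W.sigma fun v => G.neighborFinset v \ W).image fun x => s(x.1, x.2) : Finset (Sym2 V)) := by
    rintro e ⟨he, u, hu, v, hv, rfl⟩
    simp only [Finset.coe_image, Set.mem_image]
    exact ⟨⟨u, v⟩, by simpa using ⟨hu, he, hv⟩, rfl⟩
  calc (edgeBoundary G (W : Set V)).ncard ≤ _ := Set.ncard_le_ncard hsub (Finset.finite_toSet _)
    _ ≤ _ := by
      rw [Set.ncard_coe_finset]
      exact Finset.card_image_le.trans (Finset.card_sigma _ _).le

lemma cheeger_mul_le [DecidableEq V] {d : ℕ} (hd : 1 ≤ d) (W : Finset V) :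
    d * cheeger G d * W.card ≤ ∑ v ∈ W, ((G.neighborFinset v \ W).card : ℝ) := by
  rcases W.eq_empty_or_nonempty with rfl | hW
  · simp
  have hWc : (0 : ℝ) < W.card := by exact_mod_cast hW.card_pos
  have hd' : (0 : ℝ) < d := by exact_mod_cast hd
  have h1 : cheeger G d ≤ ((edgeBoundary G (W : Set V)).ncard : ℝ) / ((d : ℝ) * (W.card : ℝ)) :=
    ciInf_le (f := fun W : {W : Finset V // W.Nonempty} =>
      ((edgeBoundary G (W.1 : Set V)).ncard : ℝ) / ((d : ℝ) * (W.1.card : ℝ)))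
      ⟨0, by rintro _ ⟨W, rfl⟩; positivity⟩ ⟨W, hW⟩
  rw [le_div_iff₀ (by positivity)] at h1
  have h2 : ((edgeBoundary G (W : Set V)).ncard : ℝ) ≤
      ∑ v ∈ W, ((G.neighborFinset v \ W).card : ℝ) := by exact_mod_cast ncard_edgeBoundary_le G W
  linarith

/-- The sum of `max (f u) (f v)` over all oriented edges `(u, v)`. -/
noncomputable def edgeMaxSum (f : V → ℝ≥0) : ℝ≥0∞ :=
  ∑' v, ∑ v' ∈ G.neighborFinset v, ((max (f v) (f v') : ℝ≥0) : ℝ≥0∞)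

lemma edgeMaxSum_indicator_ge {d : ℕ} (hd : 1 ≤ d) (hreg : G.IsRegularOfDegree d)
    (W : Finset V) :
    ENNReal.ofReal (d * (1 + cheeger G d)) * W.card ≤
      edgeMaxSum G ((W : Set V).indicator 1) := by
  classical
  -- The oriented edges meeting `W` either start in `W`, `d` for each vertex, or start outside and
  -- end in `W`; the latter are counted from their end `w`.
  have hterm : ∀ v, ∑ v' ∈ G.neighborFinset v,
        ((max ((W : Set V).indicator 1 v) ((W : Set V).indicator 1 v') : ℝ≥0) : ℝ≥0∞) =
      (if v ∈ W then (d : ℝ≥0∞) else 0) +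
        ∑ w ∈ W, if v ∈ G.neighborFinset w \ W then 1 else 0 := by
    intro v
    by_cases hv : v ∈ W
    · simp only [hv, if_true]
      rw [Finset.sum_congr rfl (g := fun _ => (1 : ℝ≥0∞))]
      · simp [hreg.degree_eq v, hv]
      · intro v' _
        by_cases hv' : v' ∈ W <;> simp [hv, hv', Set.indicator]
    · simp only [hv, if_false, zero_add]
      simp only [Finset.mem_sdiff, hv, not_false_eq_true, and_true, SimpleGraph.mem_neighborFinset,
        Set.indicator, Finset.mem_coe, if_false, Pi.one_apply]
      rw [← Finset.sum_filter, Finset.sum_congr rfl (g := fun v' => if v' ∈ W then (1 : ℝ≥0∞) else 0),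
        ← Finset.sum_filter]
      · congr 1
        ext x
        simp [and_comm, G.adj_comm]
      · intro v' _
        split_ifs <;> simp
  unfold edgeMaxSum
  simp_rw [hterm]
  rw [ENNReal.tsum_add, Summable.tsum_finsetSum (fun _ _ => ENNReal.summable)]
  have h1 : ∑' v, (if v ∈ W then (d : ℝ≥0∞) else 0) = d * W.card := by
    rw [tsum_eq_sum (s := W) (by intro b hb; simp [hb]), ← Finset.sum_filter]
    simp [mul_comm]
  have h2 : ∀ w, ∑' v, (if v ∈ G.neighborFinset w \ W then (1 : ℝ≥0∞) else 0) =
      (G.neighborFinset w \ W).card := by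
    intro w
    rw [tsum_eq_sum (s := G.neighborFinset w \ W) (by intro b hb; rw [if_neg hb]),
      ← Finset.sum_filter, Finset.filter_mem_eq_inter]
    simp
  simp_rw [h2]
  rw [h1]
  have h3 := cheeger_mul_le G hd W
  have h0 := cheeger_nonneg G d
  calc ENNReal.ofReal (d * (1 + cheeger G d)) * W.card
      = ENNReal.ofReal (d * W.card + d * cheeger G d * W.card) := by
        rw [← ENNReal.ofReal_natCast W.card, ← ENNReal.ofReal_mul (by positivity)]
        congr 1; ring
    _ ≤ ENNReal.ofReal (d * W.card + ∑ v ∈ W, ((G.neighborFinset v \ W).card : ℝ)) :=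
        ENNReal.ofReal_le_ofReal (by linarith)
    _ = _ := by
        rw [show (d * W.card + ∑ v ∈ W, ((G.neighborFinset v \ W).card : ℝ) : ℝ) =
          ((d * W.card + ∑ v ∈ W, (G.neighborFinset v \ W).card : ℕ) : ℝ) by push_cast; rfl,
          ENNReal.ofReal_natCast]
        push_cast; rfl

/-- Layer-cake form of the edge expansion. -/
lemma edgeMaxSum_ge {d : ℕ} (hd : 1 ≤ d) (hreg : G.IsRegularOfDegree d) (f : V → ℝ≥0)
    (hf : f.support.Finite) :
    ENNReal.ofReal (d * (1 + cheeger G d)) * ∑' v, (f v : ℝ≥0∞) ≤ edgeMaxSum G f := by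
  classical
  obtain ⟨n, hn⟩ : ∃ n, hf.toFinset.card = n := ⟨_, rfl⟩
  induction n using Nat.strong_induction_on generalizing f with
  | _ n ih =>
  set W := hf.toFinset with hW
  rcases W.eq_empty_or_nonempty with h0 | hne
  · have : f = 0 := by
      ext v
      by_contra hv
      have : v ∈ W := by simpa [hW] using fun h => hv (by simp [h])
      simp [h0] at this
    simp [this]
  -- Peel off the lowest layer: subtracting the minimum `m` of `f` on its support `W` removes at
  -- least `w` from the support.
  obtain ⟨w, hw, hmin⟩ := W.exists_min_image f hne
  have hmem : ∀ v, v ∈ W ↔ f v ≠ 0 := by intro v; simp [hW]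
  set m := f w with hm
  set g : V → ℝ≥0 := fun v => f v - m with hg
  have hfg : ∀ v, f v = g v + m * (W : Set V).indicator 1 v := by
    intro v
    by_cases hv : v ∈ W
    · simp [hg, Set.indicator, hv, tsub_add_cancel_of_le (hmin v hv)]
    · have : f v = 0 := by_contra fun h => hv ((hmem v).2 h)
      simp [hg, Set.indicator, hv, this]
  have hgW : ∀ v, v ∉ W → g v = 0 := by
    intro v hv
    have : f v = 0 := by_contra fun h => hv ((hmem v).2 h)
    simp [hg, this]
  have hgs : g.support ⊆ f.support := by
    intro v hv
    by_contra h
    exact hv (hgW v fun h' => h (by simpa using (hmem v).1 h'))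
  have hgf : g.support.Finite := hf.subset hgs
  have hcard : hgf.toFinset.card < n := by
    rw [← hn]
    apply Finset.card_lt_card
    rw [Finset.ssubset_iff_of_subset (by simpa [hW] using hgs)]
    exact ⟨w, hw, by simp [hg, hm]⟩
  have ihg := ih _ hcard g hgf rfl
  -- The maximum is additive here because `g` and the indicator of `W` are comonotone: `g` vanishes
  -- wherever the indicator does.
  have hmax : ∀ v v', max (f v) (f v') = max (g v) (g v') +
      m * max ((W : Set V).indicator 1 v) ((W : Set V).indicator 1 v') := by
    intro v v'
    rw [hfg v, hfg v']
    by_cases hv : v ∈ W <;> by_cases hv' : v' ∈ W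
    · simp [Set.indicator, hv, hv', max_add_add_right]
    · simp [Set.indicator, hv, hv', hgW v' hv']
    · simp [Set.indicator, hv, hv', hgW v hv]
    · simp [Set.indicator, hv, hv']
  have hE : edgeMaxSum G f = edgeMaxSum G g + m * edgeMaxSum G ((W : Set V).indicator 1) := by
    unfold edgeMaxSum
    rw [← ENNReal.tsum_mul_left, ← ENNReal.tsum_add]
    congr 1
    ext v
    rw [Finset.mul_sum, ← Finset.sum_add_distrib]
    refine Finset.sum_congr rfl fun v' _ => ?_
    rw [hmax]; push_cast; rfl
  have hS : ∑' v, (f v : ℝ≥0∞) = ∑' v, (g v : ℝ≥0∞) + m * W.card := by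
    have h1 : ∑' v, (((W : Set V).indicator 1 v : ℝ≥0) : ℝ≥0∞) = W.card := by
      rw [tsum_eq_sum (s := W) (by intro b hb; simp [Set.indicator, hb]),
        Finset.sum_congr rfl (g := fun _ => (1 : ℝ≥0∞))]
      · simp
      · intro x hx; simp [Set.indicator, hx]
    rw [← h1, ← ENNReal.tsum_mul_left, ← ENNReal.tsum_add]
    congr 1
    ext v
    conv_lhs => rw [hfg v]
    push_cast; rfl
  rw [hE, hS, mul_add, mul_left_comm]
  gcongr
  exact edgeMaxSum_indicator_ge G hd hreg W

end Expansion

end IndSetBound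

/-! ### Conditional probabilities given a set of seeds -/

namespace IndSetBound

open Real

section Seeds

variable {V : Type*}

/-- The law of an IID process. -/
noncomputable def seedMeasure (V : Type*) : Measure (V → unitInterval) :=
  Measure.infinitePi fun _ => volume

instance : IsProbabilityMeasure (seedMeasure V) := by unfold seedMeasure; infer_instance

open Classical in
/-- The seeds are those of `z` on `S` and those of `z'` outside `S`. -/
noncomputable def splice (S : Set V) (z z' : V → unitInterval) : V → unitInterval :=
  S.piecewise z z'

lemma splice_of_mem {S : Set V} {v : V} (hv : v ∈ S) (z z' : V → unitInterval) :
    splice S z z' v = z v := by simp [splice, hv]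

lemma splice_of_notMem {S : Set V} {v : V} (hv : v ∉ S) (z z' : V → unitInterval) :
    splice S z z' v = z' v := by simp [splice, hv]

lemma measurable_splice (S : Set V) :
    Measurable fun x : (V → unitInterval) × (V → unitInterval) => splice S x.1 x.2 := by
  refine measurable_pi_iff.2 fun v => ?_
  by_cases hv : v ∈ S
  · simp only [splice_of_mem hv]; fun_prop
  · simp only [splice_of_notMem hv]; fun_prop

lemma measurable_splice_right (S : Set V) (z : V → unitInterval) : Measurable (splice S z) :=
  (measurable_splice S).comp measurable_prodMk_left

/-- A finite box splits into its coordinates in `S` and those outside, and its product measure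
factors accordingly. This allows the seeds outside `S` to be resampled. -/
lemma measurePreserving_splice (S : Set V) :
    MeasurePreserving (fun x : (V → unitInterval) × (V → unitInterval) => splice S x.1 x.2)
      ((seedMeasure V).prod (seedMeasure V)) (seedMeasure V) := by
  classical
  refine ⟨measurable_splice S, Measure.eq_infinitePi _ fun s t ht => ?_⟩
  rw [Measure.map_apply (measurable_splice S)
    (MeasurableSet.pi s.countable_toSet fun i _ => ht i)]
  have : (fun x : (V → unitInterval) × (V → unitInterval) => splice S x.1 x.2) ⁻¹'
      (Set.pi (s : Set V) t) =
      (Set.pi ((s.filter (· ∈ S) : Finset V) : Set V) t) ×ˢ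
        (Set.pi ((s.filter (· ∉ S) : Finset V) : Set V) t) := by
    ext x
    simp only [Set.mem_preimage, Set.mem_pi, Set.mem_prod, Finset.coe_filter, Set.mem_ofPred_eq,
      Finset.mem_coe]
    constructor
    · intro h
      refine ⟨fun i hi => ?_, fun i hi => ?_⟩
      · simpa [splice_of_mem hi.2] using h i hi.1
      · simpa [splice_of_notMem hi.2] using h i hi.1
    · rintro ⟨h1, h2⟩ i hi
      by_cases hiS : i ∈ S
      · simpa [splice_of_mem hiS] using h1 i ⟨hi, hiS⟩
      · simpa [splice_of_notMem hiS] using h2 i ⟨hi, hiS⟩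
  rw [this, Measure.prod_prod, seedMeasure, Measure.infinitePi_pi _ fun i _ => ht i,
    Measure.infinitePi_pi _ fun i _ => ht i, Finset.prod_filter_mul_prod_filter_not]

lemma splice_splice {S S' : Set V} (h : S ⊆ S') (z y z' : V → unitInterval) :
    splice S' (splice S z y) z' = splice S z (splice S' y z') := by
  ext1 v
  by_cases hv : v ∈ S
  · rw [splice_of_mem (h hv), splice_of_mem hv, splice_of_mem hv]
  · rw [splice_of_notMem hv]
    by_cases hv' : v ∈ S'
    · rw [splice_of_mem hv', splice_of_notMem hv, splice_of_mem hv']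
    · rw [splice_of_notMem hv', splice_of_notMem hv']

/-- The conditional probability of the event `E` given the seeds on `S`. -/
noncomputable def condProb (S : Set V) (E : Set (V → unitInterval)) (z : V → unitInterval) : ℝ :=
  (seedMeasure V).real (splice S z ⁻¹' E)

lemma condProb_nonneg (S : Set V) (E : Set (V → unitInterval)) (z : V → unitInterval) :
    0 ≤ condProb S E z := measureReal_nonneg

lemma condProb_le_one (S : Set V) (E : Set (V → unitInterval)) (z : V → unitInterval) :
    condProb S E z ≤ 1 := measureReal_le_one

lemma measurable_condProb (S : Set V) {E : Set (V → unitInterval)} (hE : MeasurableSet E) :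
    Measurable (condProb S E) :=
  (measurable_measure_prodMk_left (ν := seedMeasure V) (measurable_splice S hE)).ennreal_toReal

lemma integrable_of_bounds {α : Type*} [MeasurableSpace α] {μ : Measure α} [IsFiniteMeasure μ]
    {f : α → ℝ} (hf : Measurable f) {a b : ℝ} (h : ∀ x, f x ∈ Icc a b) : Integrable f μ :=
  Integrable.of_mem_Icc a b hf.aemeasurable (Filter.Eventually.of_forall h)

lemma integrable_condProb (S : Set V) {E : Set (V → unitInterval)} (hE : MeasurableSet E)
    (μ : Measure (V → unitInterval)) [IsFiniteMeasure μ] : Integrable (condProb S E) μ :=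
  integrable_of_bounds (measurable_condProb S hE)
    fun z => ⟨condProb_nonneg S E z, condProb_le_one S E z⟩

lemma integral_condProb (S : Set V) {E : Set (V → unitInterval)} (hE : MeasurableSet E) :
    ∫ z, condProb S E z ∂seedMeasure V = (seedMeasure V).real E := by
  have hm := measurable_splice S hE
  rw [← (measurePreserving_splice S).measureReal_preimage hE.nullMeasurableSet, measureReal_def,
    Measure.prod_apply hm]
  exact integral_toReal (measurable_measure_prodMk_left hm).aemeasurable
    (Filter.Eventually.of_forall fun _ => measure_lt_top _ _)

/-- The tower property of conditional probabilities. -/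
lemma integral_condProb_splice {S S' : Set V} (h : S ⊆ S') {E : Set (V → unitInterval)}
    (hE : MeasurableSet E) (z : V → unitInterval) :
    ∫ y, condProb S' E (splice S z y) ∂seedMeasure V = condProb S E z := by
  rw [condProb, ← integral_condProb S' (measurable_splice_right S z hE)]
  congr 1
  ext y
  simp only [condProb, ← Set.preimage_comp]
  congr 2
  ext1 z'
  exact splice_splice h z y z'

lemma integral_splice (S : Set V) {f : (V → unitInterval) → ℝ} (hf : Measurable f) {a b : ℝ}
    (h : ∀ x, f x ∈ Icc a b) :
    ∫ z, ∫ y, f (splice S z y) ∂seedMeasure V ∂seedMeasure V = ∫ z, f z ∂seedMeasure V := by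
  rw [← integral_prod (fun x : (V → unitInterval) × (V → unitInterval) => f (splice S x.1 x.2))
    (integrable_of_bounds (hf.comp (measurable_splice S)) fun _ => h _)]
  conv_rhs => rw [← (measurePreserving_splice S).map_eq]
  exact (integral_map (measurable_splice S).aemeasurable hf.aestronglyMeasurable).symm

lemma condProb_iUnion {ι : Type*} (s : Finset ι) (S : Set V) {E : ι → Set (V → unitInterval)}
    (hE : ∀ i, MeasurableSet (E i)) (hd : Pairwise (Function.onFun Disjoint E))
    (z : V → unitInterval) :
    condProb S (⋃ i ∈ s, E i) z = ∑ i ∈ s, condProb S (E i) z := by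
  simp only [condProb, Set.preimage_iUnion]
  exact measureReal_biUnion_finset (fun i _ j _ hij => (hd hij).preimage _)
    (fun i _ => measurable_splice_right S z (hE i))

lemma condProb_empty (E : Set (V → unitInterval)) (z : V → unitInterval) :
    condProb ∅ E z = (seedMeasure V).real E := by
  have : splice ∅ z = id := by ext; simp [splice]
  simp [condProb, this]

/-- The value of `X` depends only on the seeds in `N`. -/
def DependsOnly {α : Type*} (X : (V → unitInterval) → α) (N : Set V) : Prop :=
  ∀ z z', (∀ v ∈ N, z v = z' v) → X z = X z'

lemma condProb_comp {α β : Type*} [Fintype β] [MeasurableSpace β]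
    [MeasurableSingletonClass β] (S : Set V) {X : (V → unitInterval) → β} (hX : Measurable X) (f : β → α)
    [DecidableEq α] (a : α) (z : V → unitInterval) :
    condProb S ((f ∘ X) ⁻¹' {a}) z = ∑ b with f b = a, condProb S (X ⁻¹' {b}) z := by
  rw [← condProb_iUnion _ S (fun b => hX (measurableSet_singleton b))]
  · congr 1
    ext x
    simp
  · intro b b' hb
    exact (Set.disjoint_singleton.2 hb).preimage X

/-! ### Conditional entropy given a set of seeds -/

section Entropy

variable {α β : Type*} [Fintype α] [Fintype β]

/-- The conditional entropy of `X` given the seeds on `S`. -/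
noncomputable def condEnt (S : Set V) (X : (V → unitInterval) → β) : ℝ :=
  ∫ z, ∑ b, negMulLog (condProb S (X ⁻¹' {b}) z) ∂seedMeasure V

/-- Gibbs' inequality for the conditional entropy of a finite-valued variable given its image
under `f`. -/
lemma condEnt_gibbs (f : β → α) [DecidableEq α] {p q : β → ℝ} (hp : ∀ b, 0 ≤ p b)
    (hq : ∀ b, 0 ≤ q b) (h : ∀ b, q b = 0 → p b = 0) :
    ∑ b, negMulLog (p b) - ∑ a, negMulLog (∑ b with f b = a, p b) ≤
      ∑ b, p b * (log (∑ b' with f b' = f b, q b') - log (q b)) := by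
  have hfib : ∀ g : β → ℝ, ∑ b, g b = ∑ a, ∑ b with f b = a, g b :=
    fun g => (Finset.sum_fiberwise _ f g).symm
  have h1 : ∑ a, negMulLog (∑ b with f b = a, p b) =
      ∑ b, - p b * log (∑ b' with f b' = f b, p b') := by
    rw [hfib]
    refine Finset.sum_congr rfl fun a _ => ?_
    rw [negMulLog, ← Finset.sum_neg_distrib, Finset.sum_mul]
    refine Finset.sum_congr rfl fun b hb => ?_
    rw [(Finset.mem_filter.1 hb).2]
  rw [h1, ← Finset.sum_sub_distrib]
  -- This is `log x ≤ x - 1` at `x = P q / (Q p)`, where `P`, `Q` are the masses of the fibre of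
  -- `b`. The correction terms have nonpositive sum over each fibre.
  have key : ∀ b, negMulLog (p b) - - p b * log (∑ b' with f b' = f b, p b') ≤
      p b * (log (∑ b' with f b' = f b, q b') - log (q b)) +
        ((∑ b' with f b' = f b, p b') * (q b / ∑ b' with f b' = f b, q b') - p b) := by
    intro b
    have hQ : 0 ≤ ∑ b' with f b' = f b, q b' := Finset.sum_nonneg fun _ _ => hq _
    have hP : 0 ≤ ∑ b' with f b' = f b, p b' := Finset.sum_nonneg fun _ _ => hp _
    rcases (hp b).eq_or_lt with hpb | hpb
    · rw [← hpb]
      have : 0 ≤ (∑ b' with f b' = f b, p b') * (q b / ∑ b' with f b' = f b, q b') :=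
        mul_nonneg hP (div_nonneg (hq b) hQ)
      simpa using this
    · have hqb : 0 < q b := lt_of_le_of_ne (hq b) fun h0 => hpb.ne' (h b h0.symm)
      have hQ' : 0 < ∑ b' with f b' = f b, q b' :=
        hqb.trans_le (Finset.single_le_sum (f := q) (fun _ _ => hq _) (by simp))
      have hP' : 0 < ∑ b' with f b' = f b, p b' :=
        hpb.trans_le (Finset.single_le_sum (f := p) (fun _ _ => hp _) (by simp))
      set Q := ∑ b' with f b' = f b, q b'
      set P := ∑ b' with f b' = f b, p b'
      have hl := log_le_sub_one_of_pos (show 0 < P * q b / (Q * p b) by positivity)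
      rw [log_div (by positivity) (by positivity), log_mul hP'.ne' hqb.ne',
        log_mul hQ'.ne' hpb.ne'] at hl
      have hl' := mul_le_mul_of_nonneg_left hl hpb.le
      have : p b * (P * q b / (Q * p b) - 1) = P * (q b / Q) - p b := by
        field_simp
      rw [this] at hl'
      rw [negMulLog]
      linarith
  refine (Finset.sum_le_sum fun b _ => key b).trans ?_
  rw [Finset.sum_add_distrib]
  have hle : ∑ b, ((∑ b' with f b' = f b, p b') * (q b / ∑ b' with f b' = f b, q b') - p b) ≤ 0 := by
    rw [hfib]
    refine Finset.sum_nonpos fun a _ => ?_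
    rw [Finset.sum_sub_distrib, sub_nonpos]
    have : ∀ b ∈ Finset.univ.filter (f · = a),
        (∑ b' with f b' = f b, p b') * (q b / ∑ b' with f b' = f b, q b') =
        (∑ b' with f b' = a, p b') * (q b / ∑ b' with f b' = a, q b') := by
      intro b hb
      rw [(Finset.mem_filter.1 hb).2]
    rw [Finset.sum_congr rfl this, ← Finset.mul_sum, ← Finset.sum_div]
    exact mul_le_of_le_one_right (Finset.sum_nonneg fun _ _ => hp _) (div_self_le_one _)
  linarith

/-- The equality case `p = q` of `condEnt_gibbs`. -/
lemma gibbs_self (f : β → α) [DecidableEq α] (q : β → ℝ) :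
    ∑ b, q b * (log (∑ b' with f b' = f b, q b') - log (q b)) =
      ∑ b, negMulLog (q b) - ∑ a, negMulLog (∑ b with f b = a, q b) := by
  have h1 : ∑ a, negMulLog (∑ b with f b = a, q b) =
      ∑ b, - q b * log (∑ b' with f b' = f b, q b') := by
    rw [← Finset.sum_fiberwise _ f]
    refine Finset.sum_congr rfl fun a _ => ?_
    rw [negMulLog, ← Finset.sum_neg_distrib, Finset.sum_mul]
    refine Finset.sum_congr rfl fun b hb => ?_
    rw [(Finset.mem_filter.1 hb).2]
  rw [h1, ← Finset.sum_sub_distrib]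
  refine Finset.sum_congr rfl fun b _ => ?_
  rw [negMulLog]; ring

lemma negMulLog_condProb_mem (S : Set V) (E : Set (V → unitInterval)) (z : V → unitInterval) :
    negMulLog (condProb S E z) ∈ Icc (0 : ℝ) 1 :=
  ⟨negMulLog_nonneg (condProb_nonneg S E z) (condProb_le_one S E z),
    (negMulLog_le_one_sub_self (condProb_nonneg S E z)).trans
      (by linarith [condProb_nonneg S E z])⟩

lemma sum_negMulLog_condProb_mem (S : Set V) (X : (V → unitInterval) → β) (z : V → unitInterval) :
    ∑ b, negMulLog (condProb S (X ⁻¹' {b}) z) ∈ Icc (0 : ℝ) (Fintype.card β) :=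
  ⟨Finset.sum_nonneg fun b _ => (negMulLog_condProb_mem S _ z).1,
    (Finset.sum_le_sum fun b _ => (negMulLog_condProb_mem S (X ⁻¹' {b}) z).2).trans (by simp)⟩

lemma condEnt_nonneg (S : Set V) (X : (V → unitInterval) → β) : 0 ≤ condEnt S X :=
  integral_nonneg fun z => (sum_negMulLog_condProb_mem S X z).1

lemma condEnt_empty (X : (V → unitInterval) → β) :
    condEnt ∅ X = ∑ b, negMulLog ((seedMeasure V).real (X ⁻¹' {b})) := by
  simp [condEnt, condProb_empty]

/-- Only the revealed seeds on which `X` depends matter. -/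
lemma condEnt_congr_of_dependsOnly {X : (V → unitInterval) → β} {N S S' : Set V}
    (hN : DependsOnly X N) (h : ∀ v ∈ N, v ∈ S ↔ v ∈ S') : condEnt S X = condEnt S' X := by
  have : ∀ z z', X (splice S z z') = X (splice S' z z') := by
    intro z z'
    refine hN _ _ fun v hv => ?_
    by_cases hS : v ∈ S
    · rw [splice_of_mem hS, splice_of_mem ((h v hv).1 hS)]
    · rw [splice_of_notMem hS, splice_of_notMem fun h' => hS ((h v hv).2 h')]
  simp [condEnt, condProb, Set.preimage, this]

lemma condEnt_eq_zero_of_dependsOnly {X : (V → unitInterval) → β} {N : Set V}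
    (hN : DependsOnly X N) : condEnt N X = 0 := by
  have : ∀ z z', X (splice N z z') = X z := fun z z' =>
    hN _ _ fun v hv => splice_of_mem hv _ _
  have h2 : ∀ z b, negMulLog (condProb N (X ⁻¹' {b}) z) = 0 := by
    intro z b
    by_cases hb : X z = b <;> simp [condProb, Set.preimage, this, hb]
  simp [condEnt, h2]

variable [MeasurableSpace β] [MeasurableSingletonClass β]

lemma measurable_sum_negMulLog (S : Set V) {X : (V → unitInterval) → β} (hX : Measurable X) :
    Measurable fun z => ∑ b, negMulLog (condProb S (X ⁻¹' {b}) z) :=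
  Finset.measurable_sum _ fun b _ => continuous_negMulLog.measurable.comp
    (measurable_condProb S (hX (measurableSet_singleton b)))

lemma integrable_sum_negMulLog (S : Set V) {X : (V → unitInterval) → β} (hX : Measurable X) :
    Integrable (fun z => ∑ b, negMulLog (condProb S (X ⁻¹' {b}) z)) (seedMeasure V) :=
  integrable_of_bounds (measurable_sum_negMulLog S hX) (sum_negMulLog_condProb_mem S X)

variable [MeasurableSpace α] [MeasurableSingletonClass α]

/-- Revealing more seeds decreases the conditional entropy of `X` given `f ∘ X`. -/
lemma condEnt_sub_antitone {S S' : Set V} (h : S ⊆ S') {X : (V → unitInterval) → β}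
    (hX : Measurable X) (f : β → α) :
    condEnt S' X - condEnt S' (f ∘ X) ≤ condEnt S X - condEnt S (f ∘ X) := by
  classical
  have hfX : Measurable (f ∘ X) := (Measurable.of_discrete).comp hX
  have hXb : ∀ b, MeasurableSet (X ⁻¹' {b}) := fun b => hX (measurableSet_singleton b)
  have hsub : ∀ T : Set V, condEnt T X - condEnt T (f ∘ X) =
      ∫ z, (∑ b, negMulLog (condProb T (X ⁻¹' {b}) z) -
        ∑ a, negMulLog (condProb T ((f ∘ X) ⁻¹' {a}) z)) ∂seedMeasure V := fun T =>
    (integral_sub (integrable_sum_negMulLog T hX) (integrable_sum_negMulLog T hfX)).symm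
  have hbd : ∀ (T : Set V) z, (∑ b, negMulLog (condProb T (X ⁻¹' {b}) z) -
      ∑ a, negMulLog (condProb T ((f ∘ X) ⁻¹' {a}) z)) ∈
        Icc (-(Fintype.card α : ℝ)) (Fintype.card β) := by
    intro T z
    have h1 := sum_negMulLog_condProb_mem T X z
    have h2 := sum_negMulLog_condProb_mem T (f ∘ X) z
    exact ⟨by linarith [h1.1, h2.2], by linarith [h1.2, h2.1]⟩
  have hms : ∀ T : Set V, Measurable fun z => (∑ b, negMulLog (condProb T (X ⁻¹' {b}) z) -
      ∑ a, negMulLog (condProb T ((f ∘ X) ⁻¹' {a}) z)) := fun T =>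
    (measurable_sum_negMulLog T hX).sub (measurable_sum_negMulLog T hfX)
  -- Resampling the seeds outside `S` turns the claim into an inequality for each fixed `z`: a
  -- Jensen inequality for the concave functional "entropy of `X` given `f ∘ X`", with `q` the mean
  -- of the laws `p y`.
  rw [hsub, hsub, ← integral_splice S (hms S') (hbd S')]
  refine integral_mono (integrable_of_bounds ((hms S').comp (measurable_splice S))
    fun x => hbd S' _).integral_prod_left (integrable_of_bounds (hms S) (hbd S)) fun z => ?_
  set p : (V → unitInterval) → β → ℝ := fun y b => condProb S' (X ⁻¹' {b}) (splice S z y) with hp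
  set q : β → ℝ := fun b => condProb S (X ⁻¹' {b}) z with hq
  have hpm : ∀ b, Measurable fun y => p y b := fun b =>
    (measurable_condProb S' (hXb b)).comp (measurable_splice_right S z)
  have hpi : ∀ b, Integrable (fun y => p y b) (seedMeasure V) := fun b =>
    integrable_of_bounds (hpm b) fun y => ⟨condProb_nonneg _ _ _, condProb_le_one _ _ _⟩
  have hpq : ∀ b, ∫ y, p y b ∂seedMeasure V = q b := fun b => integral_condProb_splice h (hXb b) z
  -- Gibbs' inequality needs `p y` absolutely continuous with respect to `q`; a nonnegative function
  -- of mean zero vanishes almost everywhere.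
  have hzero : ∀ᵐ y ∂seedMeasure V, ∀ b, q b = 0 → p y b = 0 := by
    rw [ae_all_iff]
    intro b
    by_cases hb : q b = 0
    · rw [← hpq, integral_eq_zero_iff_of_nonneg (fun y => condProb_nonneg _ _ _) (hpi b)] at hb
      filter_upwards [hb] with y hy _ using hy
    · exact Filter.Eventually.of_forall fun y h => absurd h hb
  calc ∫ y, (∑ b, negMulLog (condProb S' (X ⁻¹' {b}) (splice S z y)) -
        ∑ a, negMulLog (condProb S' ((f ∘ X) ⁻¹' {a}) (splice S z y))) ∂seedMeasure V
      ≤ ∫ y, ∑ b, p y b * (log (∑ b' with f b' = f b, q b') - log (q b)) ∂seedMeasure V := by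
        refine integral_mono_ae (integrable_of_bounds
          ((hms S').comp (measurable_splice_right S z)) fun _ => hbd S' _)
          (integrable_finsetSum _ fun b _ => (hpi b).mul_const _) ?_
        filter_upwards [hzero] with y hy
        simp only [condProb_comp S' hX f]
        exact condEnt_gibbs f (fun b => condProb_nonneg _ _ _) (fun b => condProb_nonneg _ _ _) hy
    -- The Gibbs bound is linear in `p y`, so averaging over `y` replaces `p y` by `q`.
    _ = ∑ b, q b * (log (∑ b' with f b' = f b, q b') - log (q b)) := by
        rw [integral_finsetSum _ fun b _ => (hpi b).mul_const _]
        refine Finset.sum_congr rfl fun b _ => ?_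
        rw [integral_mul_const, hpq]
    _ = ∑ b, negMulLog (q b) - ∑ a, negMulLog (condProb S ((f ∘ X) ⁻¹' {a}) z) := by
        refine (gibbs_self f q).trans ?_
        simp only [condProb_comp S hX f, hq]

/-- Revealing more seeds decreases the conditional entropy. -/
lemma condEnt_antitone {S S' : Set V} (h : S ⊆ S') {X : (V → unitInterval) → β}
    (hX : Measurable X) : condEnt S' X ≤ condEnt S X := by
  have hu : ∀ T : Set V, condEnt T ((fun _ => () : β → Unit) ∘ X) = 0 := by
    intro T
    have : ∀ z, condProb T (((fun _ => () : β → Unit) ∘ X) ⁻¹' {()}) z = 1 := by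
      intro z
      simp [condProb, Set.preimage]
    simp [condEnt, this]
  have := condEnt_sub_antitone h hX (fun _ => () : β → Unit)
  simpa [hu] using this

end Entropy

end Seeds

end IndSetBound

/-! ### Information gains in a uniformly random order -/

namespace IndSetBound

section RandomOrder

variable {V : Type*}

lemma ae_seeds_ne {x y : V} (h : x ≠ y) : ∀ᵐ T ∂seedMeasure V, T x ≠ T y := by
  have hind : IndepFun (fun T : V → unitInterval => T x) (fun T => T y) (seedMeasure V) :=
    (iIndepFun_infinitePi (P := fun _ : V => (volume : Measure unitInterval))
      (X := fun _ z => z) (fun _ => measurable_id)).indepFun h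
  have hmap := (indepFun_iff_map_prod_eq_prod_map_map (measurable_pi_apply x).aemeasurable
    (measurable_pi_apply y).aemeasurable).1 hind
  have hx : (seedMeasure V).map (fun T => T x) = volume := Measure.infinitePi_map_eval _ x
  have hy : (seedMeasure V).map (fun T => T y) = volume := Measure.infinitePi_map_eval _ y
  rw [hx, hy] at hmap
  have hd : MeasurableSet {p : unitInterval × unitInterval | p.1 = p.2} :=
    measurableSet_eq_fun measurable_fst measurable_snd
  have hnull : ((volume : Measure unitInterval).prod volume) {p | p.1 = p.2} = 0 := by
    rw [Measure.measure_prod_null hd]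
    refine Filter.Eventually.of_forall fun a => ?_
    have : Prod.mk a ⁻¹' {p : unitInterval × unitInterval | p.1 = p.2} = {a} := by
      ext b; simp [eq_comm]
    simp [this]
  rw [← hmap, Measure.map_apply (by fun_prop) hd] at hnull
  rw [ae_iff]
  simpa using hnull

lemma ae_injOn (N : Finset V) : ∀ᵐ T ∂seedMeasure V, Set.InjOn T (N : Set V) := by
  have : ∀ᵐ T ∂seedMeasure V, ∀ x ∈ N, ∀ y ∈ N, x ≠ y → T x ≠ T y := by
    rw [Filter.eventually_all_finset]
    intro x _
    rw [Filter.eventually_all_finset]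
    intro y _
    by_cases h : x = y
    · simp [h]
    · filter_upwards [ae_seeds_ne h] with T hT _ using hT
  filter_upwards [this] with T hT x hx y hy hxy
  by_contra h
  exact hT x hx y hy h hxy

/-- Telescoping along the order of a finite set given by an injective function. -/
lemma sum_telescope {L : Type*} [LinearOrder L] (T : V → L) (g : Set V → ℝ) (N : Finset V)
    (hT : Set.InjOn T (N : Set V)) :
    ∑ w ∈ N, (g {x | x ∈ N ∧ T x < T w} - g (insert w {x | x ∈ N ∧ T x < T w})) = g ∅ - g N := by
  classical
  -- Adding the `T`-largest element leaves the predecessors of all the others unchanged.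
  induction N using Finset.induction_on_max_value T with
  | empty => simp
  | insert a s ha hmax ih =>
    have hinj : Set.InjOn T (s : Set V) := hT.mono (by simp)
    have hlt : ∀ x ∈ s, T x < T a := fun x hx => lt_of_le_of_ne (hmax x hx) fun h =>
      ha (hT (by simp [hx]) (by simp) h ▸ hx)
    rw [Finset.sum_insert ha]
    have h1 : {x | x ∈ insert a s ∧ T x < T a} = (s : Set V) := by
      ext x
      simp only [Finset.mem_insert, Set.mem_ofPred_eq, Finset.mem_coe]
      constructor
      · rintro ⟨rfl | h, h'⟩
        · exact absurd h' (lt_irrefl _)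
        · exact h
      · exact fun h => ⟨Or.inr h, hlt x h⟩
    have h2 : ∀ w ∈ s, {x | x ∈ insert a s ∧ T x < T w} = {x | x ∈ s ∧ T x < T w} := by
      intro w hw
      ext x
      simp only [Finset.mem_insert, Set.mem_ofPred_eq]
      constructor
      · rintro ⟨rfl | h, h'⟩
        · exact absurd h' (hlt w hw).not_gt
        · exact ⟨h, h'⟩
      · exact fun h => ⟨Or.inr h.1, h.2⟩
    rw [h1, Finset.sum_congr rfl fun w hw => by rw [h2 w hw], ih hinj, Finset.coe_insert]
    ring

/-- The vertices revealed before `w` in the order given by `T`. -/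
def before (T : V → unitInterval) (w : V) : Set V := {x | T x < T w}

section Gain

variable {α β : Type*} [Fintype α] [Fintype β]

/-- The expected mutual information of `X` and the seed of `w` given the seeds preceding `w` in a
uniformly random order. -/
noncomputable def gain (w : V) (X : (V → unitInterval) → β) : ℝ :=
  ∫ T, (condEnt (before T w) X - condEnt (insert w (before T w)) X) ∂seedMeasure V

/-- The integrand depends on `T` only through the finitely many comparisons `T x < T w` with `x ∈
N`. -/
lemma measurable_gain_integrand {X : (V → unitInterval) → β} {N : Finset V}
    (hN : DependsOnly X (N : Set V)) (w : V) :
    Measurable fun T => condEnt (before T w) X - condEnt (insert w (before T w)) X := by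
  classical
  let b : (V → unitInterval) → (N → Bool) := fun T x => decide (T x < T w)
  have hb : Measurable b := by
    refine measurable_pi_iff.2 fun x => measurable_to_bool ?_
    have : (fun T : V → unitInterval => b T x) ⁻¹' {true} = {T | T x < T w} := by
      ext T; simp [b]
    rw [this]
    exact measurableSet_lt (by fun_prop) (by fun_prop)
  let R : (N → Bool) → Set V := fun c => {v | ∃ h : v ∈ N, c ⟨v, h⟩ = true}
  have heq : (fun T => condEnt (before T w) X - condEnt (insert w (before T w)) X) =
      (fun c => condEnt (R c) X - condEnt (insert w (R c)) X) ∘ b := by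
    ext T
    have h : ∀ v ∈ (N : Set V), v ∈ before T w ↔ v ∈ R (b T) := by
      intro v hv
      have hv' : v ∈ N := hv
      simp [before, R, b, hv']
    have h' : ∀ v ∈ (N : Set V), v ∈ insert w (before T w) ↔ v ∈ insert w (R (b T)) := by
      intro v hv
      rw [Set.mem_insert_iff, Set.mem_insert_iff, h v hv]
    simp only [Function.comp]
    rw [condEnt_congr_of_dependsOnly hN h, condEnt_congr_of_dependsOnly hN h']
  rw [heq]
  exact Measurable.of_discrete.comp hb

lemma condEnt_le_card (S : Set V) (X : (V → unitInterval) → β) :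
    condEnt S X ≤ Fintype.card β := by
  have h := integral_mono_of_nonneg (μ := seedMeasure V)
    (Filter.Eventually.of_forall fun z => (sum_negMulLog_condProb_mem S X z).1)
    (integrable_const (Fintype.card β : ℝ))
    (Filter.Eventually.of_forall fun z => (sum_negMulLog_condProb_mem S X z).2)
  simpa [condEnt] using h

lemma integrable_gain_integrand {X : (V → unitInterval) → β} {N : Finset V}
    (hN : DependsOnly X (N : Set V)) (w : V) :
    Integrable (fun T => condEnt (before T w) X - condEnt (insert w (before T w)) X)
      (seedMeasure V) := by
  refine integrable_of_bounds (measurable_gain_integrand hN w)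
    (a := -(Fintype.card β : ℝ)) (b := Fintype.card β) fun T => ?_
  have h1 := condEnt_nonneg (before T w) X
  have h2 := condEnt_nonneg (insert w (before T w)) X
  have h3 := condEnt_le_card (before T w) X
  have h4 := condEnt_le_card (insert w (before T w)) X
  exact ⟨by linarith, by linarith⟩

lemma gain_eq_zero {X : (V → unitInterval) → β} {N : Set V} (hN : DependsOnly X N) {w : V}
    (hw : w ∉ N) : gain w X = 0 := by
  have : ∀ S, condEnt (insert w S) X = condEnt S X := fun S =>
    condEnt_congr_of_dependsOnly hN fun v hv => by
      rw [Set.mem_insert_iff, or_iff_right]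
      rintro rfl
      exact hw hv
  simp [gain, this]

/-- Chain rule: for almost every order the drops of entropy telescope, ending at 0 once all of `N`
is revealed. -/
lemma sum_gain {X : (V → unitInterval) → β} {N : Finset V} (hN : DependsOnly X (N : Set V)) :
    ∑ w ∈ N, gain w X = condEnt ∅ X := by
  unfold gain
  rw [← integral_finsetSum _ fun w _ => integrable_gain_integrand hN w]
  have : ∀ᵐ T ∂seedMeasure V,
      ∑ w ∈ N, (condEnt (before T w) X - condEnt (insert w (before T w)) X) = condEnt ∅ X := by
    filter_upwards [ae_injOn N] with T hT
    have h := sum_telescope T (fun S => condEnt S X) N hT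
    rw [condEnt_eq_zero_of_dependsOnly hN, sub_zero] at h
    rw [← h]
    refine Finset.sum_congr rfl fun w _ => ?_
    congr 1
    · exact condEnt_congr_of_dependsOnly hN fun v hv => by
        simp [before, Finset.mem_coe.1 hv]
    · exact condEnt_congr_of_dependsOnly hN fun v hv => by
        simp [before, Finset.mem_coe.1 hv]
  rw [integral_congr_ae this]
  simp

variable [MeasurableSpace β] [MeasurableSingletonClass β]

lemma gain_nonneg (w : V) {X : (V → unitInterval) → β} (hX : Measurable X) : 0 ≤ gain w X :=
  integral_nonneg fun _ => sub_nonneg.2 (condEnt_antitone (Set.subset_insert w _) hX)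

variable [MeasurableSpace α] [MeasurableSingletonClass α]

/-- The difference of the two gains is the mean drop of the entropy of `X` given `f ∘ X`, which is
nonnegative by `condEnt_sub_antitone`. -/
lemma gain_comp_le (w : V) {X : (V → unitInterval) → β} (hX : Measurable X) {N : Finset V}
    (hN : DependsOnly X (N : Set V)) (f : β → α) : gain w (f ∘ X) ≤ gain w X := by
  have hN' : DependsOnly (f ∘ X) (N : Set V) := fun z z' h => congrArg f (hN z z' h)
  refine integral_mono (integrable_gain_integrand hN' w) (integrable_gain_integrand hN w)
    fun T => ?_
  have := condEnt_sub_antitone (Set.subset_insert w (before T w)) hX f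
  simp only
  linarith

end Gain

/-! ### Invariance of the gains under the group -/

section Action

variable {Γ : Type*} [Group Γ] [MulAction Γ V]

/-- The action of `Γ` on configurations. -/
def shift {A : Type*} (γ : Γ) (z : V → A) : V → A := fun u => z (γ⁻¹ • u)

lemma measurePreserving_shift (γ : Γ) :
    MeasurePreserving (shift γ : (V → unitInterval) → _) (seedMeasure V) (seedMeasure V) := by
  refine ⟨measurable_pi_iff.2 fun v => measurable_pi_apply _, ?_⟩
  have h := Measure.infinitePi_map_piCongrLeft (fun _ : V => (volume : Measure unitInterval))
    (MulAction.toPerm γ)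
  have hs : (shift γ : (V → unitInterval) → V → unitInterval) =
      MeasurableEquiv.piCongrLeft (fun _ : V => unitInterval) (MulAction.toPerm γ) := by
    ext1 z
    ext1 v
    have := Equiv.piCongrLeft_apply_apply (fun _ : V => unitInterval)
      (MulAction.toPerm γ) z (γ⁻¹ • v)
    rw [MulAction.toPerm_apply, smul_inv_smul] at this
    exact this.symm
  rw [hs]
  exact h

variable {β : Type*} [MeasurableSpace β] [MeasurableSingletonClass β]

lemma condProb_shift (γ : Γ) {X X' : (V → unitInterval) → β} (h : ∀ z, X' (shift γ z) = X z)
    (hX' : Measurable X') {S S' : Set V} (hS : ∀ x, γ • x ∈ S' ↔ x ∈ S) (b : β)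
    (z : V → unitInterval) :
    condProb S' (X' ⁻¹' {b}) (shift γ z) = condProb S (X ⁻¹' {b}) z := by
  have hsp : ∀ z z', splice S' (shift γ z) (shift γ z') = shift γ (splice S z z') := by
    intro z z'
    ext1 v
    have hv : v ∈ S' ↔ γ⁻¹ • v ∈ S := by rw [← hS, smul_inv_smul]
    by_cases hvS : v ∈ S'
    · rw [splice_of_mem hvS, shift, shift, splice_of_mem (hv.1 hvS)]
    · rw [splice_of_notMem hvS, shift, shift, splice_of_notMem fun h' => hvS (hv.2 h')]
  unfold condProb
  rw [← (measurePreserving_shift γ).measureReal_preimage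
    (measurable_splice_right S' _ (hX' (measurableSet_singleton b))).nullMeasurableSet]
  congr 1
  ext z'
  simp [hsp, h]

lemma condEnt_shift [Fintype β] (γ : Γ) {X X' : (V → unitInterval) → β}
    (h : ∀ z, X' (shift γ z) = X z) (hX' : Measurable X')
    {S S' : Set V} (hS : ∀ x, γ • x ∈ S' ↔ x ∈ S) : condEnt S' X' = condEnt S X := by
  unfold condEnt
  conv_lhs => rw [← (measurePreserving_shift γ).map_eq]
  rw [integral_map (measurePreserving_shift γ).measurable.aemeasurable
    (measurable_sum_negMulLog S' hX').aestronglyMeasurable]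
  simp only [condProb_shift γ h hX' hS]

/-- The labels defining the random order are themselves IID, so they can be shifted along with the
seeds. A fixed order would not be invariant, and mass transport would not apply. -/
lemma gain_shift [Fintype β] (γ : Γ) {X X' : (V → unitInterval) → β} (h : ∀ z, X' (shift γ z) = X z)
    (hX' : Measurable X') {N : Finset V} (hN : DependsOnly X' (N : Set V)) (w : V) :
    gain (γ • w) X' = gain w X := by
  unfold gain
  conv_lhs => rw [← (measurePreserving_shift γ).map_eq]
  rw [integral_map (measurePreserving_shift γ).measurable.aemeasurable
    (measurable_gain_integrand hN _).aestronglyMeasurable]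
  congr 1
  ext T
  congr 1
  · exact condEnt_shift γ h hX' fun x => by simp [before, shift]
  · exact condEnt_shift γ h hX' fun x => by simp [before, shift]

end Action

end RandomOrder

end IndSetBound

/-! ### The entropy inequality for finite range -/

namespace IndSetBound

section FiniteRange

variable {V : Type*}

lemma tsum_gain {β : Type*} [Fintype β] [MeasurableSpace β] [MeasurableSingletonClass β]
    {X : (V → unitInterval) → β} (hX : Measurable X) {N : Finset V}
    (hN : DependsOnly X (N : Set V)) :
    ∑' w, ENNReal.ofReal (gain w X) = ENNReal.ofReal (condEnt ∅ X) := by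
  rw [tsum_eq_sum (s := N) fun w hw => by rw [gain_eq_zero hN hw, ENNReal.ofReal_zero],
    ← ENNReal.ofReal_sum_of_nonneg fun w _ => gain_nonneg w hX, sum_gain hN]

variable {Γ : Type*} [Group Γ] [MulAction Γ V]

/-- The edge-vertex entropy inequality for finite-range factors of IID. -/
lemma edge_vertex_of_finite_range (G : SimpleGraph V) [G.LocallyFinite] {d : ℕ} (hd : 1 ≤ d)
    (hreg : G.IsRegularOfDegree d)
    (hadj : ∀ (γ : Γ) u v, G.Adj (γ • u) (γ • v) ↔ G.Adj u v)
    (hmtp : MassTransportPrinciple Γ V) {X : V → (V → unitInterval) → Bool}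
    (hX : ∀ v, Measurable (X v)) (hequi : ∀ (γ : Γ) v z, X (γ • v) (shift γ z) = X v z)
    {N : V → Finset V} (hN : ∀ v, DependsOnly (X v) (N v : Set V))
    (hfin : ∀ w, {v | w ∈ N v}.Finite) (o : V) :
    d * (1 + cheeger G d) * condEnt ∅ (X o) ≤
      ∑ v ∈ G.neighborFinset o, condEnt ∅ (fun z => (X o z, X v z)) := by
  classical
  have hC : 0 ≤ d * (1 + cheeger G d) := by have := cheeger_nonneg G d; positivity
  set h : V → V → ℝ≥0 := fun w v => (gain w (X v)).toNNReal with hh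
  have hinv : ∀ (γ : Γ) w v, h (γ • w) (γ • v) = h w v := fun γ w v => by
    simp only [hh]
    rw [gain_shift γ (hequi γ v) (hX _) (hN _)]
  set k : V → V → ℝ≥0 := fun w v => ∑ v' ∈ G.neighborFinset v, max (h w v) (h w v') with hk
  have kinv : ∀ (γ : Γ) w v, k (γ • w) (γ • v) = k w v := fun γ w v => by
    simp only [hk]
    refine (Finset.sum_equiv (MulAction.toPerm γ) (fun i => ?_) fun i _ => ?_).symm
    · simp [hadj]
    · simp [hinv]
  have hpair : ∀ v, DependsOnly (fun z => (X o z, X v z)) ((N o ∪ N v : Finset V) : Set V) :=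
    fun v z z' hz => Prod.ext (hN o z z' fun u hu => hz u (by simp [Finset.mem_coe.1 hu]))
      (hN v z z' fun u hu => hz u (by simp [Finset.mem_coe.1 hu]))
  have hpm : ∀ v, Measurable fun z => (X o z, X v z) := fun v => (hX o).prodMk (hX v)
  -- One seed influences only finitely many variables, so the expansion bound applies to `h o`.
  have hsupp : (Function.support (h o)).Finite := (hfin o).subset fun v hv => by
    by_contra hmem
    exact hv (by simp only [hh]; rw [gain_eq_zero (hN v) hmem, Real.toNNReal_zero])
  have key : ENNReal.ofReal (d * (1 + cheeger G d)) * ENNReal.ofReal (condEnt ∅ (X o)) ≤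
      ∑ v ∈ G.neighborFinset o, ENNReal.ofReal (condEnt ∅ (fun z => (X o z, X v z))) := by
    calc _ = ENNReal.ofReal (d * (1 + cheeger G d)) * ∑' v, (h o v : ℝ≥0∞) := by
          rw [hmtp h hinv o, ← tsum_gain (hX o) (hN o)]
          rfl
      _ ≤ edgeMaxSum G (h o) := edgeMaxSum_ge G hd hreg _ hsupp
      _ = ∑' v, (k o v : ℝ≥0∞) := by simp [edgeMaxSum, hk]
      -- Second transport: from one seed and all edges to all seeds and the edges at `o`, where the
      -- pair gains can be summed by the chain rule.
      _ = ∑' w, (k w o : ℝ≥0∞) := hmtp k kinv o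
      _ ≤ ∑' w, ∑ v ∈ G.neighborFinset o, ENNReal.ofReal (gain w (fun z => (X o z, X v z))) := by
          refine ENNReal.tsum_le_tsum fun w => ?_
          simp only [hk]
          rw [ENNReal.ofNNReal_finsetSum]
          refine Finset.sum_le_sum fun v _ => ?_
          rw [ENNReal.ofReal, ENNReal.coe_le_coe]
          exact max_le (Real.toNNReal_le_toNNReal (gain_comp_le w (hpm v) (hpair v) Prod.fst))
            (Real.toNNReal_le_toNNReal (gain_comp_le w (hpm v) (hpair v) Prod.snd))
      _ = _ := by
          rw [Summable.tsum_finsetSum fun _ _ => ENNReal.summable]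
          exact Finset.sum_congr rfl fun v _ => tsum_gain (hpm v) (hpair v)
  rwa [← ENNReal.ofReal_mul hC, ← ENNReal.ofReal_sum_of_nonneg fun v _ => condEnt_nonneg _ _,
    ENNReal.ofReal_le_ofReal_iff (Finset.sum_nonneg fun v _ => condEnt_nonneg _ _)] at key

end FiniteRange

end IndSetBound

/-! ### Approximation by finite-range factors -/

namespace IndSetBound

open Filter Topology

section Approximation

variable {V : Type*}

/-- The more likely value of `X` given the seeds on `S`. -/
noncomputable def majority (S : Set V) (X : (V → unitInterval) → Bool) :
    (V → unitInterval) → Bool :=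
  fun z => decide (1 / 2 < condProb S (X ⁻¹' {true}) z)

lemma measurable_majority (S : Set V) {X : (V → unitInterval) → Bool} (hX : Measurable X) :
    Measurable (majority S X) := by
  refine measurable_to_bool ?_
  have : majority S X ⁻¹' {true} = {z | 1 / 2 < condProb S (X ⁻¹' {true}) z} := by
    ext z; simp [majority]
  rw [this]
  exact measurableSet_lt measurable_const
    (measurable_condProb S (hX (measurableSet_singleton true)))

lemma dependsOnly_majority (S : Set V) (X : (V → unitInterval) → Bool) :
    DependsOnly (majority S X) S := by
  intro z z' h
  have : splice S z = splice S z' := by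
    ext1 y
    ext1 v
    by_cases hv : v ∈ S
    · rw [splice_of_mem hv, splice_of_mem hv, h v hv]
    · rw [splice_of_notMem hv, splice_of_notMem hv]
  simp [majority, condProb, this]

lemma majority_shift {Γ : Type*} [Group Γ] [MulAction Γ V] (γ : Γ)
    {X X' : (V → unitInterval) → Bool} (h : ∀ z, X' (shift γ z) = X z) (hX' : Measurable X')
    {S S' : Set V} (hS : ∀ x, γ • x ∈ S' ↔ x ∈ S) (z : V → unitInterval) :
    majority S' X' (shift γ z) = majority S X z := by
  simp only [majority, condProb_shift γ h hX' hS]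

/-- Let `D` be the symmetric difference. The seeds on `S` decide `C`, so outside `D` the majority is
correct whenever `D` has conditional probability below `1/2`. Markov's inequality bounds the
remaining set by `2 P(D)`, and `D` itself adds `P(D)`. -/
lemma measureReal_majority_ne_le {S N : Set V} (hNS : N ⊆ S) {X : (V → unitInterval) → Bool}
    (hX : Measurable X) {C : Set (V → unitInterval)} (hC : MeasurableSet C)
    (hN : DependsOnly (· ∈ C) N) :
    (seedMeasure V).real {z | majority S X z ≠ X z} ≤
      3 * (seedMeasure V).real (symmDiff C (X ⁻¹' {true})) := by
  set E := X ⁻¹' {true} with hE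
  have hEm : MeasurableSet E := hX (measurableSet_singleton true)
  set D := symmDiff C E with hD
  have hDm : MeasurableSet D := hC.symmDiff hEm
  have hmarkov := mul_meas_ge_le_integral_of_nonneg (μ := seedMeasure V)
    (Eventually.of_forall fun z => condProb_nonneg S D z) (integrable_condProb S hDm _) (1 / 2)
  rw [integral_condProb S hDm] at hmarkov
  have hsub : {z | majority S X z ≠ X z} ⊆ D ∪ {z | 1 / 2 ≤ condProb S D z} := by
    intro z hz
    by_contra hcon
    rw [Set.mem_union, not_or] at hcon
    obtain ⟨hzD, hzP⟩ := hcon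
    simp only [Set.mem_ofPred_eq, not_le] at hzP
    have hCz : ∀ y, splice S z y ∈ C ↔ z ∈ C := fun y =>
      iff_of_eq (hN _ _ fun v hv => splice_of_mem (hNS hv) z y)
    have hCE : z ∈ C ↔ z ∈ E := by
      rw [hD, Set.mem_symmDiff] at hzD
      tauto
    apply hz
    by_cases hzE : z ∈ E
    · have hXz : X z = true := hzE
      have h1 : (Set.univ : Set (V → unitInterval)) ⊆ splice S z ⁻¹' E ∪ splice S z ⁻¹' D := by
        intro y _
        have := (hCz y).2 (hCE.2 hzE)
        by_cases hy : splice S z y ∈ E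
        · exact Or.inl hy
        · exact Or.inr (Or.inl ⟨this, hy⟩)
      have h2 : 1 ≤ condProb S E z + condProb S D z := by
        have := (measureReal_mono (μ := seedMeasure V) h1).trans (measureReal_union_le _ _)
        simpa [condProb] using this
      rw [hXz, majority, decide_eq_true_eq]
      linarith
    · have hXz : X z = false := by
        simpa [hE] using hzE
      have h1 : splice S z ⁻¹' E ⊆ splice S z ⁻¹' D := by
        intro y hy
        exact Or.inr ⟨hy, fun hc => hzE (hCE.1 ((hCz y).1 hc))⟩
      have h2 : condProb S E z ≤ condProb S D z := measureReal_mono (μ := seedMeasure V) h1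
      rw [hXz, majority, decide_eq_false_iff_not]
      linarith
  have h := (measureReal_mono (μ := seedMeasure V) hsub).trans (measureReal_union_le _ _)
  linarith

/-- Every event is determined by finitely many seeds up to a small error. -/
lemma exists_finset_majority {X : (V → unitInterval) → Bool} (hX : Measurable X) {ε : ℝ}
    (hε : 0 < ε) : ∃ N : Finset V, ∀ S : Set V, (N : Set V) ⊆ S →
      (seedMeasure V).real {z | majority S X z ≠ X z} < ε := by
  obtain ⟨C, hC, hCE⟩ := exists_measure_symmDiff_lt_of_generateFrom_isSetRing (μ := seedMeasure V)
    (isSetRing_measurableCylinders (α := fun _ : V => unitInterval))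
    ⟨{Set.univ}, Set.countable_singleton _,
      Set.singleton_subset_iff.2 (univ_mem_measurableCylinders _),
      by simp⟩
    generateFrom_measurableCylinders.symm (hX (measurableSet_singleton true))
    (ε := ENNReal.ofReal (ε / 3)) (by simpa using by positivity)
  obtain ⟨N, T, hT, rfl⟩ := (mem_measurableCylinders C).1 hC
  refine ⟨N, fun S hS => ?_⟩
  have hdep : DependsOnly (· ∈ cylinder N T) (N : Set V) := by
    intro z z' h
    have : N.restrict z = N.restrict z' := by
      ext1 v
      exact h v v.2
    simp [cylinder, this]
  have h1 := measureReal_majority_ne_le hS hX (MeasurableSet.cylinder N hT) hdep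
  have h2 : (seedMeasure V).real (symmDiff (cylinder N T) (X ⁻¹' {true})) < ε / 3 := by
    rw [measureReal_def]
    exact ENNReal.toReal_lt_of_lt_ofReal hCE
  linarith

lemma tendsto_condEnt_empty {β : Type*} [Fintype β]
    {Y : ℕ → (V → unitInterval) → β} {Y' : (V → unitInterval) → β}
    (h : Tendsto (fun n => (seedMeasure V).real {z | Y n z ≠ Y' z}) atTop (𝓝 0)) :
    Tendsto (fun n => condEnt ∅ (Y n)) atTop (𝓝 (condEnt ∅ Y')) := by
  simp only [condEnt_empty]
  refine tendsto_finsetSum _ fun b _ => (Real.continuous_negMulLog.tendsto _).comp ?_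
  rw [tendsto_iff_norm_sub_tendsto_zero]
  refine squeeze_zero (fun _ => norm_nonneg _) (fun n => ?_) h
  rw [Real.norm_eq_abs, abs_sub_le_iff]
  have h1 : Y n ⁻¹' {b} ⊆ Y' ⁻¹' {b} ∪ {z | Y n z ≠ Y' z} := by
    intro z hz
    by_cases hne : Y n z = Y' z
    · exact Or.inl (hne.symm.trans hz)
    · exact Or.inr hne
  have h2 : Y' ⁻¹' {b} ⊆ Y n ⁻¹' {b} ∪ {z | Y n z ≠ Y' z} := by
    intro z hz
    by_cases hne : Y n z = Y' z
    · exact Or.inl (hne.trans hz)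
    · exact Or.inr hne
  have h3 := (measureReal_mono (μ := seedMeasure V) h1).trans (measureReal_union_le _ _)
  have h4 := (measureReal_mono (μ := seedMeasure V) h2).trans (measureReal_union_le _ _)
  exact ⟨by linarith, by linarith⟩

end Approximation

/-! ### Balls in the graph -/

section Balls

variable {V : Type*} (G : SimpleGraph V) [G.LocallyFinite]

open Classical in
/-- The vertices that are reached from `v` by a walk of length at most `r`. -/
noncomputable def walkBall : ℕ → V → Finset V
  | 0, v => {v}
  | r + 1, v => insert v ((G.neighborFinset v).biUnion (walkBall r))

lemma mem_walkBall_succ {r : ℕ} {v w : V} :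
    w ∈ walkBall G (r + 1) v ↔ w = v ∨ ∃ u, G.Adj v u ∧ w ∈ walkBall G r u := by
  simp [walkBall]

lemma smul_mem_walkBall {Γ : Type*} [Group Γ] [MulAction Γ V]
    (hadj : ∀ (γ : Γ) u v, G.Adj (γ • u) (γ • v) ↔ G.Adj u v) (γ : Γ) (r : ℕ) (v w : V) :
    γ • w ∈ walkBall G r (γ • v) ↔ w ∈ walkBall G r v := by
  induction r generalizing v with
  | zero => simp [walkBall]
  | succ r ih =>
    rw [mem_walkBall_succ, mem_walkBall_succ, smul_left_cancel_iff,
      (MulAction.surjective γ).exists]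
    simp only [hadj, ih]

/-- Supplies the finite influence of each seed required by `edge_vertex_of_finite_range`. -/
lemma finite_setOf_mem_walkBall (r : ℕ) (w : V) : {v | w ∈ walkBall G r v}.Finite := by
  induction r with
  | zero => simp [walkBall, Set.finite_singleton]
  | succ r ih =>
    refine ((Set.finite_singleton w).union
      (ih.biUnion fun u _ => (G.neighborFinset u).finite_toSet)).subset fun v hv => ?_
    rcases (mem_walkBall_succ G).1 hv with rfl | ⟨u, hu, hw⟩
    · exact Or.inl rfl
    · refine Or.inr (Set.mem_biUnion hw ?_)
      simpa using hu.symm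

lemma mem_walkBall_of_walk {v w : V} (p : G.Walk v w) {r : ℕ} (hr : p.length ≤ r) :
    w ∈ walkBall G r v := by
  induction p generalizing r with
  | nil => cases r <;> simp [walkBall]
  | cons h q ih =>
    cases r with
    | zero => simp at hr
    | succ r =>
      exact (mem_walkBall_succ G).2 (Or.inr ⟨_, h, ih (by simpa using hr)⟩)

lemma eventually_subset_walkBall (hG : G.Connected) (N : Finset V) (v : V) :
    ∀ᶠ r in atTop, (N : Set V) ⊆ walkBall G r v := by
  have : ∀ᶠ r in atTop, ∀ w ∈ N, w ∈ walkBall G r v := by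
    rw [Filter.eventually_all_finset]
    intro w _
    obtain ⟨p⟩ := hG v w
    filter_upwards [eventually_ge_atTop p.length] with r hr using mem_walkBall_of_walk G p hr
  exact this

end Balls

/-- The edge-vertex entropy inequality for factors of IID. -/
lemma edge_vertex {V Γ : Type*} [Group Γ] [MulAction Γ V] (G : SimpleGraph V)
    [G.LocallyFinite] {d : ℕ} (hd : 1 ≤ d) (hG : G.Connected) (hreg : G.IsRegularOfDegree d)
    (hadj : ∀ (γ : Γ) u v, G.Adj (γ • u) (γ • v) ↔ G.Adj u v)
    (hmtp : MassTransportPrinciple Γ V) {X : V → (V → unitInterval) → Bool}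
    (hX : ∀ v, Measurable (X v)) (hequi : ∀ (γ : Γ) v z, X (γ • v) (shift γ z) = X v z) (o : V) :
    d * (1 + cheeger G d) * condEnt ∅ (X o) ≤
      ∑ v ∈ G.neighborFinset o, condEnt ∅ (fun z => (X o z, X v z)) := by
  -- Balls move with the group, so the majority rule on them stays equivariant; connectedness makes
  -- them absorb any finite set of seeds.
  set Y : ℕ → V → (V → unitInterval) → Bool :=
    fun r v => majority (walkBall G r v : Set V) (X v) with hY
  have hle : ∀ r, d * (1 + cheeger G d) * condEnt ∅ (Y r o) ≤
      ∑ v ∈ G.neighborFinset o, condEnt ∅ (fun z => (Y r o z, Y r v z)) := by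
    intro r
    have hYm : ∀ v, Measurable (Y r v) := fun v => measurable_majority _ (hX v)
    have hYe : ∀ (γ : Γ) v z, Y r (γ • v) (shift γ z) = Y r v z := fun γ v z =>
      majority_shift γ (hequi γ v) (hX (γ • v))
        (fun x => by simpa using smul_mem_walkBall G hadj γ r v x) z
    have hYd : ∀ v, DependsOnly (Y r v) (walkBall G r v : Set V) :=
      fun v => dependsOnly_majority _ _
    exact edge_vertex_of_finite_range G hd hreg hadj hmtp hYm hYe hYd
      (finite_setOf_mem_walkBall G r) o
  have hlim : ∀ v, Tendsto (fun r => (seedMeasure V).real {z | Y r v z ≠ X v z}) atTop (𝓝 0) := by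
    intro v
    refine tendsto_order.2 ⟨fun a ha => Eventually.of_forall fun r =>
      ha.trans_le measureReal_nonneg, fun ε hε => ?_⟩
    obtain ⟨N, hN⟩ := exists_finset_majority (hX v) hε
    filter_upwards [eventually_subset_walkBall G hG N v] with r hr using hN _ hr
  have hpair : ∀ v, Tendsto (fun r => (seedMeasure V).real
      {z | (Y r o z, Y r v z) ≠ (X o z, X v z)}) atTop (𝓝 0) := by
    intro v
    have hsum := (hlim o).add (hlim v)
    rw [add_zero] at hsum
    refine squeeze_zero (fun _ => measureReal_nonneg) (fun r => ?_) hsum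
    refine (measureReal_mono (μ := seedMeasure V) (fun z hz => ?_)).trans (measureReal_union_le _ _)
    by_contra hcon
    rw [Set.mem_union, not_or] at hcon
    simp only [Set.mem_ofPred_eq, not_not] at hcon
    exact hz (Prod.ext hcon.1 hcon.2)
  have hl1 := (tendsto_condEnt_empty (hlim o)).const_mul (d * (1 + cheeger G d))
  have hl2 : Tendsto (fun r => ∑ v ∈ G.neighborFinset o, condEnt ∅ (fun z => (Y r o z, Y r v z)))
      atTop (𝓝 (∑ v ∈ G.neighborFinset o, condEnt ∅ (fun z => (X o z, X v z)))) := by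
    refine tendsto_finsetSum _ fun v _ => tendsto_condEnt_empty (hpair v)
  exact le_of_tendsto_of_tendsto' hl1 hl2 hle

end IndSetBound

/-! ### From entropy to density -/

namespace IndSetBound

section Density

variable {V Γ : Type*} [Group Γ] [MulAction Γ V]

lemma condEnt_empty_bool {X : (V → unitInterval) → Bool} (hX : Measurable X) :
    condEnt ∅ X = vertexEnt ((seedMeasure V).real (X ⁻¹' {true})) := by
  have hc : X ⁻¹' {false} = (X ⁻¹' {true})ᶜ := by
    ext z; simp
  rw [condEnt_empty, Fintype.sum_bool, vertexEnt, hc,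
    probReal_compl_eq_one_sub (hX (measurableSet_singleton true))]

/-- The joint law has masses `0, p, p, 1 - 2p`, the last being nonnegative. -/
lemma condEnt_empty_pair {X X' : (V → unitInterval) → Bool} (hX : Measurable X)
    (hX' : Measurable X') {p : ℝ} (hp : (seedMeasure V).real (X ⁻¹' {true}) = p)
    (hp' : (seedMeasure V).real (X' ⁻¹' {true}) = p)
    (hdisj : (seedMeasure V).real (X ⁻¹' {true} ∩ X' ⁻¹' {true}) = 0) :
    p ≤ 1 / 2 ∧ condEnt ∅ (fun z => (X z, X' z)) = edgeEnt p := by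
  set A := X ⁻¹' {true} with hA
  set B := X' ⁻¹' {true} with hB
  have hAm : MeasurableSet A := hX (measurableSet_singleton true)
  have hBm : MeasurableSet B := hX' (measurableSet_singleton true)
  have h11 : (fun z => (X z, X' z)) ⁻¹' {(true, true)} = A ∩ B := by
    ext z; simp [hA, hB, Prod.ext_iff]
  have h10 : (fun z => (X z, X' z)) ⁻¹' {(true, false)} = A \ B := by
    ext z; simp [hA, hB, Prod.ext_iff]
  have h01 : (fun z => (X z, X' z)) ⁻¹' {(false, true)} = B \ A := by
    ext z; simp [hA, hB, Prod.ext_iff, and_comm]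
  have h00 : (fun z => (X z, X' z)) ⁻¹' {(false, false)} = (A ∪ B)ᶜ := by
    ext z; simp [hA, hB, Prod.ext_iff]
  have e10 := measureReal_inter_add_sdiff (μ := seedMeasure V) (s := A) hBm
  have e01 := measureReal_inter_add_sdiff (μ := seedMeasure V) (s := B) hAm
  rw [Set.inter_comm] at e01
  have eu := measureReal_union_add_inter (μ := seedMeasure V) (s := A) hBm
  have ec := probReal_compl_eq_one_sub (μ := seedMeasure V) (hAm.union hBm)
  have hu : (seedMeasure V).real (A ∪ B) ≤ 1 := measureReal_le_one
  rw [hdisj, hp] at e10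
  rw [hdisj, hp'] at e01
  rw [hdisj, hp, hp'] at eu
  refine ⟨by linarith, ?_⟩
  rw [condEnt_empty, Fintype.sum_prod_type, Fintype.sum_bool, Fintype.sum_bool, Fintype.sum_bool,
    h11, h10, h01, h00, hdisj, edgeEnt, ec, show (seedMeasure V).real (A \ B) = p by linarith,
    show (seedMeasure V).real (B \ A) = p by linarith,
    show 1 - (seedMeasure V).real (A ∪ B) = 1 - 2 * p by linarith, Real.negMulLog_zero]
  ring

lemma IsUniformIID.map_eq {Ω : Type*} [MeasurableSpace Ω] {P : Measure Ω}
    [IsProbabilityMeasure P] {Z : V → Ω → unitInterval} (hZ : IsUniformIID P Z) :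
    P.map (fun ω v => Z v ω) = seedMeasure V := by
  rw [(iIndepFun_iff_map_fun_eq_infinitePi_map hZ.measurable).1 hZ.indep, seedMeasure]
  congr 1
  ext1 v
  exact hZ.uniform v

/-- The density bound for factor-of-IID independent sets that are equivariant under a transitive
group of automorphisms satisfying the Mass-Transport Principle. -/
theorem density_le (G : SimpleGraph V) [G.LocallyFinite] {d : ℕ} (hd : 1 ≤ d)
    (hG : G.Connected) (hreg : G.IsRegularOfDegree d)
    (hadj : ∀ (γ : Γ) u v, G.Adj (γ • u) (γ • v) ↔ G.Adj u v)
    (htrans : MulAction.IsPretransitive Γ V) (hmtp : MassTransportPrinciple Γ V)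
    {Ω : Type*} [MeasurableSpace Ω] (P : Measure Ω) [IsProbabilityMeasure P]
    (X : V → Ω → Bool) (hX : IsFactorOfIIDIndepSet Γ G P X) (o : V) :
    P.real {ω | X o ω = true} ≤ phiInv (cheeger G d) := by
  obtain ⟨⟨Z, F, hZ, hF, hequi, hXF⟩, hind⟩ := hX
  -- Passing to the space of seeds makes equivariance exact, while independence of the set holds
  -- only almost surely.
  set Y : V → (V → unitInterval) → Bool := fun v z => F z v with hY
  have hYm : ∀ v, Measurable (Y v) := fun v => (measurable_pi_apply v).comp hF
  have hYe : ∀ (γ : Γ) v z, Y (γ • v) (shift γ z) = Y v z := fun γ v z => by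
    have := hequi γ z (γ • v)
    rwa [inv_smul_smul] at this
  have hZm : Measurable fun ω v => Z v ω := measurable_pi_iff.2 hZ.measurable
  have hlaw : ∀ E, MeasurableSet E → P.real ((fun ω v => Z v ω) ⁻¹' E) = (seedMeasure V).real E :=
    fun E hE => by rw [← hZ.map_eq, map_measureReal_apply hZm hE]
  set p := (seedMeasure V).real (Y o ⁻¹' {true}) with hp
  have hpv : ∀ v, (seedMeasure V).real (Y v ⁻¹' {true}) = p := by
    intro v
    obtain ⟨γ, rfl⟩ := htrans.exists_smul_eq o v
    rw [← (measurePreserving_shift γ).measureReal_preimage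
      (hYm _ (measurableSet_singleton true)).nullMeasurableSet, hp]
    congr 1
    ext z
    simp [hYe]
  have hPp : P.real {ω | X o ω = true} = p := by
    rw [hp, ← hlaw _ (hYm o (measurableSet_singleton true))]
    refine measureReal_congr (Filter.eventuallyEq_set.2 ?_)
    filter_upwards [hXF o] with ω hω
    simp [hω, hY]
  have hdisj : ∀ u v, G.Adj u v →
      (seedMeasure V).real (Y u ⁻¹' {true} ∩ Y v ⁻¹' {true}) = 0 := by
    intro u v huv
    rw [← hlaw _ ((hYm u (measurableSet_singleton true)).inter
      (hYm v (measurableSet_singleton true))), measureReal_eq_zero_iff]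
    rw [measure_eq_zero_iff_ae_notMem]
    filter_upwards [hXF u, hXF v, hind] with ω hu hv hi hmem
    exact hi (hu.trans hmem.1) (hv.trans hmem.2) huv.ne huv
  have hpair : ∀ v ∈ G.neighborFinset o, _ := fun v hv =>
    condEnt_empty_pair (hYm o) (hYm v) (hpv o) (hpv v)
      (hdisj o v ((G.mem_neighborFinset o v).1 hv))
  have hcard : (G.neighborFinset o).card = d := hreg o
  have hp2 : p ≤ 1 / 2 := by
    obtain ⟨v, hv⟩ := Finset.card_pos.1 (hcard ▸ hd : 0 < (G.neighborFinset o).card)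
    exact (hpair v hv).1
  have hev := edge_vertex G hd hG hreg hadj hmtp hYm hYe o
  rw [Finset.sum_congr rfl fun v hv => (hpair v hv).2, Finset.sum_const, hcard, nsmul_eq_mul,
    condEnt_empty_bool (hYm o), mul_assoc] at hev
  rw [hPp]
  exact le_phiInv measureReal_nonneg hp2
    (le_of_mul_le_mul_left hev (by exact_mod_cast hd))

end Density

/-! ### Cayley graphs -/

section Cayley

variable {Γ : Type*} [Group Γ]

lemma massTransportPrinciple_self : MassTransportPrinciple Γ Γ := by
  intro h hinv o
  -- The bijection `v ↦ o v⁻¹ o`: left translation by `o v⁻¹` takes the pair `(o, v)` to `(o v⁻¹ o,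
  -- o)`.
  let e : Γ ≃ Γ := (Equiv.inv Γ).trans ((Equiv.mulLeft o).trans (Equiv.mulRight o))
  rw [← e.tsum_eq fun v => (h v o : ℝ≥0∞)]
  refine tsum_congr fun v => ?_
  have := hinv (o * v⁻¹) o v
  simp only [smul_eq_mul, inv_mul_cancel_right] at this
  rw [← this]
  rfl

lemma mulCayley_adj_iff {S : Finset Γ} (h1 : 1 ∉ S) (hinv : ∀ s ∈ S, s⁻¹ ∈ S) (u v : Γ) :
    (SimpleGraph.mulCayley (S : Set Γ)).Adj u v ↔ u⁻¹ * v ∈ S := by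
  rw [SimpleGraph.mulCayley_adj]
  constructor
  · rintro ⟨_, h | h⟩
    · exact h
    · simpa using hinv _ h
  · refine fun h => ⟨?_, Or.inl h⟩
    rintro rfl
    simp [h1] at h

lemma connected_mulCayley {S : Finset Γ} (h1 : 1 ∉ S) (hinv : ∀ s ∈ S, s⁻¹ ∈ S)
    (hgen : Subgroup.closure (S : Set Γ) = ⊤) :
    (SimpleGraph.mulCayley (S : Set Γ)).Connected := by
  have hreach : ∀ g u : Γ, (SimpleGraph.mulCayley (S : Set Γ)).Reachable u (u * g) := by
    intro g
    have hg : g ∈ Subgroup.closure (S : Set Γ) := hgen ▸ Subgroup.mem_top g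
    induction hg using Subgroup.closure_induction with
    | mem s hs =>
      intro u
      exact SimpleGraph.Adj.reachable ((mulCayley_adj_iff h1 hinv _ _).2 (by simpa using hs))
    | one => intro u; simp
    | mul a b _ _ ha hb => intro u; rw [← mul_assoc]; exact (ha u).trans (hb _)
    | inv a _ ha => intro u; simpa using (ha (u * a⁻¹)).symm
  have : Nonempty Γ := ⟨1⟩
  exact ⟨fun u v => by simpa using hreach (u⁻¹ * v) u⟩

end Cayley

end IndSetBound

open IndSetBound in
theorem theorem3 :
    -- `φ` maps `(0, 1/2)` continuously and decreasingly onto `(0, 1)`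
    (ContinuousOn phi (Ioo 0 (1 / 2)) ∧ StrictAntiOn phi (Ioo 0 (1 / 2)) ∧
      BijOn phi (Ioo 0 (1 / 2)) (Ioo 0 1)) ∧
    -- unimodular transitive graphs, with `Aut(G)`-factors
    (∀ {V : Type*} (G : SimpleGraph V) [G.LocallyFinite] (d : ℕ),
      1 ≤ d → G.Connected → G.IsRegularOfDegree d → IsTransitive G → IsUnimodular G →
      ∀ {Ω : Type*} [MeasurableSpace Ω] (P : Measure Ω) [IsProbabilityMeasure P]
        (X : V → Ω → Bool), IsFactorOfIIDIndepSet (G ≃g G) G P X →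
        ∀ o : V, P.real {ω | X o ω = true} ≤ phiInv (cheeger G d)) ∧
    -- Cayley graphs, with factors that are only assumed equivariant under left translations
    (∀ {Γ : Type*} [Group Γ] (S : Finset Γ),
      S.Nonempty → 1 ∉ S → (∀ s ∈ S, s⁻¹ ∈ S) → Subgroup.closure (S : Set Γ) = ⊤ →
      ∀ {Ω : Type*} [MeasurableSpace Ω] (P : Measure Ω) [IsProbabilityMeasure P]
        (X : Γ → Ω → Bool),
        IsFactorOfIIDIndepSet Γ (SimpleGraph.mulCayley (S : Set Γ)) P X →
        ∀ o : Γ, P.real {ω | X o ω = true} ≤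
          phiInv (cheeger (SimpleGraph.mulCayley (S : Set Γ)) S.card)) := by
  refine ⟨⟨continuousOn_phi_Ioc.mono Ioo_subset_Ioc_self,
    strictAntiOn_phi_Ioc.mono Ioo_subset_Ioc_self, bijOn_phi⟩, ?_, ?_⟩
  · intro V G _ d hd hG hreg htrans huni Ω _ P _ X hX o
    exact density_le G hd hG hreg (fun γ u v => γ.map_adj_iff) htrans huni P X hX o
  · intro Γ _ S hS h1 hinv hgen Ω _ P _ X hX o
    classical
    have hset : ∀ g : Γ, (SimpleGraph.mulCayley (S : Set Γ)).neighborSet g =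
        (S.image (g * ·) : Finset Γ) := by
      intro g
      ext v
      simp only [SimpleGraph.mem_neighborSet, mulCayley_adj_iff h1 hinv, Finset.coe_image,
        Set.mem_image, Finset.mem_coe]
      exact ⟨fun h => ⟨_, h, by simp⟩, by rintro ⟨s, hs, rfl⟩; simpa using hs⟩
    -- The choice of this instance is harmless, as `cheeger` does not involve it.
    let _ : (SimpleGraph.mulCayley (S : Set Γ)).LocallyFinite := fun g =>
      Fintype.ofFinset (S.image (g * ·)) fun v => by rw [hset]; rfl
    have hreg : (SimpleGraph.mulCayley (S : Set Γ)).IsRegularOfDegree S.card := by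
      intro g
      rw [← SimpleGraph.card_neighborFinset_eq_degree, ← Set.ncard_coe_finset,
        SimpleGraph.coe_neighborFinset, hset, Set.ncard_coe_finset,
        Finset.card_image_of_injective _ (mul_right_injective g)]
    exact density_le _ hS.card_pos (connected_mulCayley h1 hinv hgen) hreg
      (fun γ u v => SimpleGraph.mulCayley_adj_mul_iff_right) inferInstance
      massTransportPrinciple_self P X hX o
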